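/- Let $\mathcal H$ be a complex Hilbert space; all operators are bounded. A real linear operator $A$ on $\mathcal H$ is *antilinear* if $Ai=-iA$; its adjoint is defined by $\operatorname{Re}(Ax,y)=\operatorname{Re}(x,A^*y)$ for all $x,y$, and $A$ is *self-adjoint* if $A=A^*$. Its spectrum $\sigma(A)$ is the set of $\lambda\in\mathbb C$ for which $A-\lambda$ is not invertible among the bounded real linear operators. A *unitary conjugation* is a norm-preserving antilinear operator $\tau$ with $\tau^2=I$. An *antilinear orthogonal projection* onto a closed subspace $\mathcal M$ is a real linear operator that restricts to a unitary conjugation on $\mathcal M$ and is zero on $\mathcal M^\perp$. A *spectral measure* on a compact set $K\subset\mathbb R$ assigns to each Borel set $M\subset K$ an orthogonal projection $E(M)$, with $E(K)=I$ and $E(\bigcup_n M_n)x=\sum_n E(M_n)x$ for all disjoint sequences $(M_n)$ and all $x\in\mathcal H$. Integrals $\int\lambda\,dE(\lambda)$ and $\int\lambda\,dF(\lambda)$ are norm limits of the integrals of simple functions converging uniformly to $\lambda$. (1) Let $H$ be complex linear and self-adjoint. There is exactly one spectral measure $E$ on $\sigma(H)$ with $H=\int_{\sigma(H)}\lambda\,dE(\lambda)$.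 If $\tau$ is antilinear and $\tau H=H\tau$, then $E(M)\tau=\tau E(M)$ for every Borel set $M\subset\sigma(H)$. (2) Let $A$ be antilinear and self-adjoint, and let $|A|$ be the complex linear positive square root of $A^*A$, so that $|A|$ is positive and $|A|^2=A^*A$. Then $\sigma(|A|)=\sigma(A)\cap[0,\infty)$, and there is a unitary conjugation $\tau$ with $A=|A|\tau=\tau|A|$. Let $\tau$ be any such conjugation, let $E$ be the spectral measure of $|A|$, and put $F(M)=E(M)\tau$ for Borel sets $M\subset\sigma(|A|)$. Then: * $A=\int_{\sigma(|A|)}\lambda\,dF(\lambda)$; * for every Borel set $M\subset\sigma(|A|)$ the operator $F(M)$ is antilinear and is an antilinear orthogonal projection onto the range of $E(M)$, with $F(M)^2=E(M)$ and $F(M)^*=F(M)$; * $F(\sigma(|A|))=F(\sigma(A)\cap[0,\infty))=\tau$; * $F(\bigcup_n M_n)x=\sum_n F(M_n)x$ for every disjoint sequence $(M_n)$ of Borel subsets of $\sigma(|A|)$ and every $x\in\mathcal H$. -/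

import Mathlib

open Filter Topology MeasureTheory

section Operators

variable {H : Type*} [NormedAddCommGroup H] [InnerProductSpace ℂ H]

/-- A bounded real linear operator `A` on a complex Hilbert space is antilinear if `A i = -i A`. -/
def IsAntilinear (A : H →L[ℝ] H) : Prop :=
  ∀ x : H, A (Complex.I • x) = -(Complex.I • A x)

/-- Unitary conjugations: antilinear involutions that preserve the norm.
(Being involutions, they are bijective.) -/
structure IsUnitaryConjugation (τ : H →L[ℝ] H) : Prop where
  antilinear : IsAntilinear τ
  involutive : ∀ x, τ (τ x) = x
  isometric : ∀ x, ‖τ x‖ = ‖x‖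

/-- `F` is an antilinear orthogonal projection onto the closed subspace `M`: it restricts to a
unitary conjugation on `M`, and it vanishes on the orthogonal complement of `M`. -/
structure IsAntilinearProjectionOnto (F : H →L[ℝ] H) (M : Submodule ℂ H) : Prop where
  isClosed : IsClosed (M : Set H)
  mapsTo : ∀ x ∈ M, F x ∈ M
  antilinear : ∀ x ∈ M, F (Complex.I • x) = -(Complex.I • F x)
  involutive : ∀ x ∈ M, F (F x) = x
  isometric : ∀ x ∈ M, ‖F x‖ = ‖x‖
  eq_zero : ∀ x ∈ Mᗮ, F x = 0

/-- The spectrum of a real linear operator: the complex numbers `z` such that `A - z` is not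
invertible in the algebra of bounded real linear operators. -/
def realLinearSpectrum (A : H →L[ℝ] H) : Set ℂ :=
  {z | ¬ IsUnit (A - (z • ContinuousLinearMap.id ℂ H).restrictScalars ℝ)}

variable [CompleteSpace H]

/-- The adjoint of a bounded real linear operator: `Re (A x, y) = Re (x, A* y)`. It is the Hilbert
space adjoint for the real inner product `Re (x, y)`. -/
noncomputable def realAdjoint (A : H →L[ℝ] H) : H →L[ℝ] H :=
  letI : InnerProductSpace ℝ H := InnerProductSpace.complexToReal
  ContinuousLinearMap.adjoint A

theorem re_inner_realAdjoint (A : H →L[ℝ] H) (x y : H) :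
    (inner ℂ (A x) y).re = (inner ℂ x (realAdjoint A y)).re :=
  letI : InnerProductSpace ℝ H := InnerProductSpace.complexToReal
  (ContinuousLinearMap.adjoint_inner_right A x y).symm

/-- A bounded real linear operator is self-adjoint if `A = A*`. -/
def IsRealSelfAdjoint (A : H →L[ℝ] H) : Prop := A = realAdjoint A

/-- `A* A` commutes with multiplication by `i` when `A` is antilinear. -/
theorem IsAntilinear.realAdjoint_mul_self_I {A : H →L[ℝ] H} (hA : IsAntilinear A) (x : H) :
    (realAdjoint A * A) (Complex.I • x) = Complex.I • (realAdjoint A * A) x := by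
  have key : ∀ u v : H, (inner ℂ (Complex.I • u) v).re = -(inner ℂ u (Complex.I • v)).re := by
    intro u v
    rw [inner_smul_left, inner_smul_right]
    simp
  have ext : ∀ u v : H, (∀ y, (inner ℂ y u).re = (inner ℂ y v).re) → u = v :=
    fun u v h =>
      letI : InnerProductSpace ℝ H := InnerProductSpace.complexToReal
      ext_inner_left ℝ h
  refine ext _ _ fun y => ?_
  change (inner ℂ y (realAdjoint A (A (Complex.I • x)))).re =
    (inner ℂ y (Complex.I • realAdjoint A (A x))).re
  rw [← neg_neg (inner ℂ y (Complex.I • realAdjoint A (A x))).re, ← key, ← re_inner_realAdjoint,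
    ← re_inner_realAdjoint, hA, hA, inner_neg_left, inner_neg_right, Complex.neg_re,
    Complex.neg_re, key, neg_neg]

/-- The operator `A* A`, as a complex linear operator, for an antilinear operator `A`. -/
noncomputable def IsAntilinear.adjointMulSelf {A : H →L[ℝ] H} (hA : IsAntilinear A) : H →L[ℂ] H where
  toFun := realAdjoint A * A
  map_add' := map_add _
  map_smul' := by
    intro c x
    have h : c • x = c.re • x + c.im • (Complex.I • x) := by
      conv_lhs => rw [← Complex.re_add_im c, add_smul, mul_smul]
      rfl
    have h' : c • (realAdjoint A * A) x = c.re • (realAdjoint A * A) x + c.im • (Complex.I • (realAdjoint A * A) x) := by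
      conv_lhs => rw [← Complex.re_add_im c, add_smul, mul_smul]
      rfl
    rw [RingHom.id_apply, h, h', map_add, map_smul, map_smul, hA.realAdjoint_mul_self_I]
  cont := (realAdjoint A * A).continuous

/-- The modulus `|A|` of an antilinear operator: the positive complex linear square root
of `A* A`. -/
noncomputable def IsAntilinear.modulus {A : H →L[ℝ] H} (hA : IsAntilinear A) : H →L[ℂ] H :=
  CFC.sqrt hA.adjointMulSelf

/-- `τ` is a unitary conjugation with `A = |A| τ = τ |A|`. -/
structure IsPolarConjugation {A : H →L[ℝ] H} (hA : IsAntilinear A) (τ : H →L[ℝ] H) : Prop where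
  isUnitaryConjugation : IsUnitaryConjugation τ
  eq_modulus_mul : A = hA.modulus.restrictScalars ℝ * τ
  eq_mul_modulus : A = τ * hA.modulus.restrictScalars ℝ

end Operators

/-- A spectral measure on a measurable space: a strongly countably additive map from measurable
sets to orthogonal projections, with total mass the identity. By convention it is `0` on sets that
are not measurable. -/
structure SpectralMeasure (Ω : Type*) [MeasurableSpace Ω] (H : Type*) [NormedAddCommGroup H]
    [InnerProductSpace ℂ H] [CompleteSpace H] where
  toFun : Set Ω → H →L[ℂ] H
  isStarProjection : ∀ M, MeasurableSet M → IsStarProjection (toFun M)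
  map_univ : toFun Set.univ = 1
  hasSum_iUnion : ∀ M : ℕ → Set Ω, (∀ n, MeasurableSet (M n)) →
    Pairwise (fun m n => Disjoint (M m) (M n)) →
    ∀ x, HasSum (fun n => toFun (M n) x) (toFun (⋃ n, M n) x)
  not_measurable : ∀ M, ¬ MeasurableSet M → toFun M = 0

section Integral

variable {Ω : Type*} [MeasurableSpace Ω] {V : Type*} [NormedAddCommGroup V] [NormedSpace ℝ V]

/-- The integral `∑ c, c G({s = c})` of a real simple function against a set function `G`. -/
noncomputable def simpleSpectralIntegral (G : Set Ω → V) (s : SimpleFunc Ω ℝ) : V :=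
  ∑ c ∈ s.range, c • G (s ⁻¹' {c})

/-- `T = ∫ f dG` as the integral of a uniform limit of simple functions: such approximating
sequences exist, and the integrals along each of them converge to `T` in norm. -/
def HasSpectralIntegral (G : Set Ω → V) (f : Ω → ℝ) (T : V) : Prop :=
  (∃ s : ℕ → SimpleFunc Ω ℝ, TendstoUniformly (fun n ω => s n ω) f atTop) ∧
  ∀ s : ℕ → SimpleFunc Ω ℝ, TendstoUniformly (fun n ω => s n ω) f atTop →
    Tendsto (fun n => simpleSpectralIntegral G (s n)) atTop (𝓝 T)

end Integral

section

variable {H : Type*} [NormedAddCommGroup H] [InnerProductSpace ℂ H] [CompleteSpace H]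

/-- `E` is the spectral measure of the self-adjoint operator `T`: it lives on the Borel subsets of
the spectrum of `T` and `T = ∫ t dE(t)`. The spectrum of a self-adjoint operator is real, so it is
taken as a set of real numbers. -/
def IsSpectralMeasureOf (T : H →L[ℂ] H) (E : SpectralMeasure (spectrum ℝ T) H) : Prop :=
  HasSpectralIntegral E.toFun (fun t => (t : ℝ)) T

/-- The antilinear measure `F(M) = E(M) τ`. -/
noncomputable def antilinearSpectralMeasure {Ω : Type*} [MeasurableSpace Ω]
    (E : SpectralMeasure Ω H) (τ : H →L[ℝ] H) (M : Set Ω) : H →L[ℝ] H :=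
  (E.toFun M).restrictScalars ℝ * τ

end

/-! ### Real parts of inner products, and difference-of-squares identities. -/

section InnerProduct

variable {H : Type*} [NormedAddCommGroup H] [InnerProductSpace ℂ H]

/-! Let `φ` be the real continuous functional calculus of a self-adjoint operator `T`. For each `x`
the functional `f ↦ ⟨x, φ f x⟩` is positive, so it is integration against a Riesz measure `μ_x`, and
`‖φ f x‖² = ∫ f² dμ_x`. If continuous functions with values in `[0, 1]` tend to the indicator of `M`
in `L¹(μ_x)`, then the vectors `φ (f n) x` converge. The limits define `E(M) x`, and `⟨x, E(M) x⟩ =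
‖E(M) x‖² = μ_x(M)` makes `E(M)` a projection, countably additive in `M`. Uniqueness is a moment
problem: the numbers `⟨x, Tᵏ x⟩` are the moments of `⟨x, E(·) x⟩`, and they determine a finite
measure on a compact set (`measure_eq_of_moments_eq`). A real linear `τ` that commutes with `T`
commutes with real polynomials in `T`, hence with `φ` and with the limits `E(M)`; real coefficients
are what lets `τ` be antilinear.

For `A` antilinear and self-adjoint, `A² = |A|²` and `A` commutes with `|A|`. The map `|A| x ↦ A x`
extends to an isometric antilinear involution of the closure of the range of `|A|`; any unitary
conjugation of the orthogonal complement completes it to `τ`. The spectra are compared through `(A -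
r)(A + r) = (|A| - r)(|A| + r)`. Since `τ` commutes with `|A|`, it commutes with `E(M)`, and the
properties of `F(M) = E(M) τ` follow from those of `E` and `τ`. -/

theorem re_inner_comm (x y : H) : (inner ℂ x y).re = (inner ℂ y x).re :=
  inner_re_symm (𝕜 := ℂ) x y

theorem mem_realLinearSpectrum_ofReal {A : H →L[ℝ] H} {r : ℝ} :
    (r : ℂ) ∈ realLinearSpectrum A ↔ ¬ IsUnit (A - r • (1 : H →L[ℝ] H)) := by
  have : ((r : ℂ) • ContinuousLinearMap.id ℂ H).restrictScalars ℝ = r • (1 : H →L[ℝ] H) := by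
    ext x
    exact Complex.coe_smul r x
  rw [← this]
  rfl

/-- The product depends only on the square of `A`, which is what allows `A` and `|A|` to be
compared. -/
theorem sub_smul_one_mul_add_smul_one (A : H →L[ℝ] H) (r : ℝ) :
    (A - r • (1 : H →L[ℝ] H)) * (A + r • (1 : H →L[ℝ] H)) = A * A - (r * r) • 1 ∧
    (A + r • (1 : H →L[ℝ] H)) * (A - r • (1 : H →L[ℝ] H)) = A * A - (r * r) • 1 := by
  constructor
  all_goals
    simp only [sub_mul, mul_add, add_mul, mul_sub, mul_smul_comm, smul_mul_assoc, mul_one,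
      one_mul, smul_smul, smul_sub, smul_add]
    abel

theorem commute_sub_add (A : H →L[ℝ] H) (r : ℝ) :
    Commute (A - r • (1 : H →L[ℝ] H)) (A + r • (1 : H →L[ℝ] H)) :=
  (sub_smul_one_mul_add_smul_one A r).1.trans (sub_smul_one_mul_add_smul_one A r).2.symm

/-- Polarization turns preservation of the norm into preservation of the real inner product; the
involution then moves `τ` to the other side. -/
theorem IsUnitaryConjugation.re_inner_left {τ : H →L[ℝ] H} (hτ : IsUnitaryConjugation τ) (x y : H) :
    (inner ℂ (τ x) y).re = (inner ℂ x (τ y)).re := by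
  have key : ∀ u v : H, (inner ℂ (τ u) (τ v)).re = (inner ℂ u v).re := by
    intro u v
    have h1 := norm_add_sq (𝕜 := ℂ) (τ u) (τ v)
    have h2 := norm_add_sq (𝕜 := ℂ) u v
    rw [← map_add, hτ.isometric, hτ.isometric, hτ.isometric] at h1
    simp only [RCLike.re_eq_complex_re] at h1 h2
    linarith
  rw [← key x, hτ.involutive]

theorem starAlgHom_inner_left [CompleteSpace H] {X : Type*} [TopologicalSpace X]
    (φ : C(X, ℝ) →⋆ₐ[ℝ] (H →L[ℂ] H)) (f : C(X, ℝ)) (x y : H) :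
    inner ℂ (φ f x) y = inner ℂ x (φ f y) := by
  have h : star (φ f) = φ f := by rw [← map_star, star_trivial]
  rw [← ContinuousLinearMap.adjoint_inner_right, ← ContinuousLinearMap.star_eq_adjoint, h]

theorem starAlgHom_re_inner_mul_self [CompleteSpace H] {X : Type*} [TopologicalSpace X]
    (φ : C(X, ℝ) →⋆ₐ[ℝ] (H →L[ℂ] H)) (f : C(X, ℝ)) (x : H) :
    (inner ℂ x (φ (f * f) x)).re = ‖φ f x‖ ^ 2 := by
  rw [map_mul, mul_apply_eq_comp, ← starAlgHom_inner_left]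
  exact inner_self_eq_norm_sq (𝕜 := ℂ) _

end InnerProduct

theorem integrable_indicator_one {X : Type*} [MeasurableSpace X] (ν : Measure X)
    [IsFiniteMeasure ν] {M : Set X} (hM : MeasurableSet M) :
    Integrable (M.indicator (1 : X → ℝ)) ν :=
  (integrable_const (1 : ℝ)).indicator hM

/-! ### Riesz measures and the projections attached to indicator functions. -/

section FunctionalCalculusMeasure

variable {H : Type*} [NormedAddCommGroup H] [InnerProductSpace ℂ H] [CompleteSpace H]
variable {X : Type*} [MetricSpace X] [CompactSpace X] [MeasurableSpace X] [BorelSpace X]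

theorem continuousMap_integrable (ν : Measure X) [IsFiniteMeasure ν] (f : C(X, ℝ)) :
    Integrable f ν :=
  f.continuous.integrable_of_hasCompactSupport (HasCompactSupport.of_compactSpace f)

/-- Riesz representation of the positive functional `f ↦ ⟨x, φ f x⟩`. -/
theorem exists_measure_integral_eq (φ : C(X, ℝ) →⋆ₐ[ℝ] (H →L[ℂ] H)) (x : H) :
    ∃ μ : Measure X, IsFiniteMeasure μ ∧
      ∀ f : C(X, ℝ), ∫ t, f t ∂μ = (inner ℂ x (φ f x)).re := by
  let L : CompactlySupportedContinuousMap X ℝ →ₗ[ℝ] ℝ :=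
    { toFun := fun f => (inner ℂ x (φ f.toContinuousMap x)).re
      map_add' := fun f g => by
        have : (f + g).toContinuousMap = f.toContinuousMap + g.toContinuousMap := rfl
        rw [this, map_add, add_apply, inner_add_right, Complex.add_re]
      map_smul' := fun c f => by
        have : (c • f).toContinuousMap = c • f.toContinuousMap := rfl
        rw [this, map_smul, smul_apply, inner_smul_right_eq_smul,
          Complex.smul_re, RingHom.id_apply] }
  have hL : ∀ f, 0 ≤ f → 0 ≤ L f := by
    intro f hf
    -- A nonnegative `f` is the square of `√f`, so the functional takes the value `‖φ (√f) x‖²`.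
    have h : f.toContinuousMap =
        (⟨fun t => √(f t), by fun_prop⟩ : C(X, ℝ)) * ⟨fun t => √(f t), by fun_prop⟩ := by
      ext t
      exact (Real.mul_self_sqrt (hf t)).symm
    change 0 ≤ (inner ℂ x (φ f.toContinuousMap x)).re
    rw [h, starAlgHom_re_inner_mul_self]
    positivity
  refine ⟨RealRMK.rieszMeasure (PositiveLinearMap.mk₀ L hL), inferInstance, fun f => ?_⟩
  exact RealRMK.integral_rieszMeasure (PositiveLinearMap.mk₀ L hL)
    (CompactlySupportedContinuousMap.continuousMapEquiv f)

/-- The measure `μ_x` with `∫ f dμ_x = ⟨x, φ f x⟩` for all continuous `f`. -/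
noncomputable def vectorMeasureOf (φ : C(X, ℝ) →⋆ₐ[ℝ] (H →L[ℂ] H)) (x : H) : Measure X :=
  (exists_measure_integral_eq φ x).choose

instance (φ : C(X, ℝ) →⋆ₐ[ℝ] (H →L[ℂ] H)) (x : H) : IsFiniteMeasure (vectorMeasureOf φ x) :=
  (exists_measure_integral_eq φ x).choose_spec.1

theorem integral_vectorMeasureOf (φ : C(X, ℝ) →⋆ₐ[ℝ] (H →L[ℂ] H)) (x : H) (f : C(X, ℝ)) :
    ∫ t, f t ∂vectorMeasureOf φ x = (inner ℂ x (φ f x)).re :=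
  (exists_measure_integral_eq φ x).choose_spec.2 f

theorem vectorMeasureOf_real_univ (φ : C(X, ℝ) →⋆ₐ[ℝ] (H →L[ℂ] H)) (x : H) :
    (vectorMeasureOf φ x).real Set.univ = ‖x‖ ^ 2 := by
  have h := integral_vectorMeasureOf φ x 1
  rw [map_one] at h
  simp only [ContinuousMap.one_apply, integral_const, smul_eq_mul, mul_one] at h
  rw [h]
  exact inner_self_eq_norm_sq (𝕜 := ℂ) _

theorem norm_sq_starAlgHom_apply (φ : C(X, ℝ) →⋆ₐ[ℝ] (H →L[ℂ] H)) (x : H) (f : C(X, ℝ)) :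
    ‖φ f x‖ ^ 2 = ∫ t, f t * f t ∂vectorMeasureOf φ x := by
  rw [← starAlgHom_re_inner_mul_self, ← integral_vectorMeasureOf]
  rfl

/-- Continuous functions with values in `[0, 1]` that converge in `L¹(ν)` to the indicator
function of `M`. -/
structure IsIndicatorApprox (ν : Measure X) (M : Set X) (f : ℕ → C(X, ℝ)) : Prop where
  mem_Icc : ∀ n t, f n t ∈ Set.Icc (0 : ℝ) 1
  tendsto : Tendsto (fun n => ∫ t, |f n t - M.indicator 1 t| ∂ν) atTop (𝓝 0)

theorem integrable_abs_sub_indicator (ν : Measure X) [IsFiniteMeasure ν] {M : Set X}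
    (hM : MeasurableSet M) (f : C(X, ℝ)) :
    Integrable (fun t => |f t - M.indicator 1 t|) ν :=
  ((continuousMap_integrable ν f).sub (integrable_indicator_one ν hM)).abs

theorem exists_isIndicatorApprox (ν : Measure X) [IsFiniteMeasure ν] {M : Set X}
    (hM : MeasurableSet M) : ∃ f, IsIndicatorApprox ν M f := by
  have key : ∀ n : ℕ, ∃ f : C(X, ℝ), (∀ t, f t ∈ Set.Icc (0 : ℝ) 1) ∧
      ∫ t, |f t - M.indicator 1 t| ∂ν ≤ 1 / ((n : ℝ) + 1) := by
    intro n
    obtain ⟨g, hg, -⟩ := (integrable_indicator_one ν hM).exists_boundedContinuous_integral_sub_le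
      (Nat.one_div_pos_of_nat (α := ℝ) (n := n))
    -- Truncation to `[0, 1]` is 1-Lipschitz and fixes the indicator, so it does not increase the
    -- `L¹` error.
    let f : C(X, ℝ) := ⟨fun t => max 0 (min 1 (g t)), by fun_prop⟩
    refine ⟨f, fun t => ⟨le_max_left _ _, max_le zero_le_one (min_le_left _ _)⟩, le_trans ?_ hg⟩
    refine integral_mono (integrable_abs_sub_indicator ν hM f)
      ((integrable_indicator_one ν hM).sub
        (continuousMap_integrable ν g.toContinuousMap)).norm fun t => ?_
    change |max 0 (min 1 (g t)) - M.indicator 1 t| ≤ |M.indicator 1 t - g t|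
    rw [abs_sub_comm (M.indicator (1 : X → ℝ) t)]
    have h : M.indicator (1 : X → ℝ) t = max 0 (min 1 (M.indicator (1 : X → ℝ) t)) := by
      by_cases ht : t ∈ M <;> simp [ht]
    conv_lhs => rw [h]
    rw [max_comm, max_comm 0]
    refine (abs_max_sub_max_le_abs (min 1 (g t)) (min 1 (M.indicator (1 : X → ℝ) t)) 0).trans ?_
    rw [min_comm, min_comm 1]
    exact abs_inf_sub_inf_le_abs (g t) (M.indicator (1 : X → ℝ) t) 1
  choose f hf hf' using key
  exact ⟨f, hf, squeeze_zero (fun _ => integral_nonneg fun _ => abs_nonneg _) hf'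
    tendsto_one_div_add_atTop_nhds_zero_nat⟩

namespace IsIndicatorApprox

variable {μ ν : Measure X} {M : Set X} {f g : ℕ → C(X, ℝ)}

theorem mono [IsFiniteMeasure ν] (h : IsIndicatorApprox ν M f) (hM : MeasurableSet M)
    (hμ : μ ≤ ν) : IsIndicatorApprox μ M f where
  mem_Icc := h.mem_Icc
  tendsto := squeeze_zero (fun _ => integral_nonneg fun _ => abs_nonneg _)
    (fun n => integral_mono_measure hμ (ae_of_all _ fun _ => abs_nonneg _)
      (integrable_abs_sub_indicator ν hM (f n))) h.tendsto

theorem tendsto_integral [IsFiniteMeasure ν] (h : IsIndicatorApprox ν M f)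
    (hM : MeasurableSet M) : Tendsto (fun n => ∫ t, f n t ∂ν) atTop (𝓝 (ν.real M)) := by
  rw [← integral_indicator_one hM]
  refine tendsto_iff_norm_sub_tendsto_zero.2 (squeeze_zero (fun n => norm_nonneg _)
    (fun n => ?_) h.tendsto)
  rw [← integral_sub (continuousMap_integrable ν _) (integrable_indicator_one ν hM)]
  exact norm_integral_le_integral_norm _

/-- With `1_M = 1_M²`, the error of the square factors as `|f + 1_M| |f - 1_M| ≤ 2 |f - 1_M|`. It is
needed to evaluate the limit of `‖φ (f n) x‖² = ∫ (f n)² dμ_x`. -/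
theorem mul_self [IsFiniteMeasure ν] (h : IsIndicatorApprox ν M f) (hM : MeasurableSet M) :
    IsIndicatorApprox ν M fun n => f n * f n where
  mem_Icc n t := by
    have := h.mem_Icc n t
    exact ⟨mul_nonneg this.1 this.1, mul_le_one₀ this.2 this.1 this.2⟩
  tendsto := by
    have h2 := h.tendsto.const_mul 2
    rw [mul_zero] at h2
    refine squeeze_zero (fun _ => integral_nonneg fun _ => abs_nonneg _) (fun n => ?_) h2
    rw [← integral_const_mul]
    refine integral_mono (integrable_abs_sub_indicator ν hM _)
      ((integrable_abs_sub_indicator ν hM _).const_mul 2) fun t => ?_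
    have h01 := h.mem_Icc n t
    have e : M.indicator (1 : X → ℝ) t = M.indicator 1 t * M.indicator 1 t := by
      by_cases ht : t ∈ M <;> simp [ht]
    have e' : |f n t + M.indicator 1 t| ≤ 2 := by
      by_cases ht : t ∈ M <;> simp [ht, abs_le] <;> constructor <;> linarith [h01.1, h01.2]
    change |f n t * f n t - M.indicator 1 t| ≤ 2 * |f n t - M.indicator 1 t|
    calc |f n t * f n t - M.indicator 1 t|
        = |f n t + M.indicator 1 t| * |f n t - M.indicator 1 t| := by
          rw [← abs_mul]; congr 1; linear_combination -e
      _ ≤ _ := by gcongr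

/-- The squared norm of the difference is `∫ (f - g)² dμ_x ≤ ∫ |f - g| dμ_x`, because `|f - g| ≤ 1`.
The free indices `p`, `q` serve two purposes: with `f = g` the result is the Cauchy property, and
with two sequences it shows that the limit does not depend on the choice. -/
theorem tendsto_sub {φ : C(X, ℝ) →⋆ₐ[ℝ] (H →L[ℂ] H)} {x : H} {ι : Type*} {l : Filter ι}
    {p q : ι → ℕ} (hp : Tendsto p l atTop) (hq : Tendsto q l atTop)
    (hf : IsIndicatorApprox (vectorMeasureOf φ x) M f)
    (hg : IsIndicatorApprox (vectorMeasureOf φ x) M g) (hM : MeasurableSet M) :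
    Tendsto (fun i => φ (f (p i)) x - φ (g (q i)) x) l (𝓝 0) := by
  set ν := vectorMeasureOf φ x
  have h0 := (hf.tendsto.comp hp).add (hg.tendsto.comp hq)
  rw [add_zero] at h0
  have h1 : Tendsto (fun i => ‖φ (f (p i)) x - φ (g (q i)) x‖ ^ 2) l (𝓝 0) := by
    refine squeeze_zero (fun i => by positivity) (fun i => ?_) h0
    rw [← sub_apply, ← map_sub, norm_sq_starAlgHom_apply]
    simp only [Function.comp_apply]
    rw [← integral_add (integrable_abs_sub_indicator ν hM _)
      (integrable_abs_sub_indicator ν hM _)]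
    refine integral_mono (continuousMap_integrable ν ((f (p i) - g (q i)) * (f (p i) - g (q i))))
      ((integrable_abs_sub_indicator ν hM _).add (integrable_abs_sub_indicator ν hM _))
      fun t => ?_
    have hf1 := hf.mem_Icc (p i) t
    have hg1 := hg.mem_Icc (q i) t
    have hle : |f (p i) t - g (q i) t| ≤ 1 := by
      rw [abs_le]; constructor <;> linarith [hf1.1, hf1.2, hg1.1, hg1.2]
    change (f (p i) t - g (q i) t) * (f (p i) t - g (q i) t) ≤ _
    rw [← abs_mul_abs_self]
    calc |f (p i) t - g (q i) t| * |f (p i) t - g (q i) t|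
        ≤ 1 * |f (p i) t - g (q i) t| := by gcongr
      _ ≤ |f (p i) t - M.indicator 1 t| + |M.indicator 1 t - g (q i) t| := by
          rw [one_mul]; exact abs_sub_le _ _ _
      _ = _ := by rw [abs_sub_comm (M.indicator (1 : X → ℝ) t)]
  refine tendsto_zero_iff_norm_tendsto_zero.2 ?_
  have h2 := h1.sqrt
  simpa using h2

end IsIndicatorApprox

theorem exists_tendsto_of_isIndicatorApprox (φ : C(X, ℝ) →⋆ₐ[ℝ] (H →L[ℂ] H)) {M : Set X}
    (hM : MeasurableSet M) (x : H) :
    ∃ v, ∀ f, IsIndicatorApprox (vectorMeasureOf φ x) M f →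
      Tendsto (fun n => φ (f n) x) atTop (𝓝 v) := by
  obtain ⟨g, hg⟩ := exists_isIndicatorApprox (vectorMeasureOf φ x) hM
  have hc : CauchySeq fun n => φ (g n) x := by
    rw [cauchySeq_iff_tendsto, uniformity_eq_comap_nhds_zero, tendsto_comap_iff]
    have := hg.tendsto_sub (p := Prod.snd) (q := Prod.fst) (l := (atTop : Filter (ℕ × ℕ)))
      (by rw [← prod_atTop_atTop_eq]; exact tendsto_snd)
      (by rw [← prod_atTop_atTop_eq]; exact tendsto_fst) hg hM
    exact this
  obtain ⟨v, hv⟩ := cauchySeq_tendsto_of_complete hc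
  refine ⟨v, fun f hf => ?_⟩
  have h := (hf.tendsto_sub tendsto_id tendsto_id hg hM).add hv
  simpa using h

/-- The value of the indicator function of `M` in the functional calculus `φ`, applied to `x`. -/
noncomputable def indicatorCalculusFun (φ : C(X, ℝ) →⋆ₐ[ℝ] (H →L[ℂ] H)) {M : Set X}
    (hM : MeasurableSet M) (x : H) : H :=
  (exists_tendsto_of_isIndicatorApprox φ hM x).choose

theorem IsIndicatorApprox.tendsto_calculus {φ : C(X, ℝ) →⋆ₐ[ℝ] (H →L[ℂ] H)} {M : Set X}
    {x : H} {f : ℕ → C(X, ℝ)} (hf : IsIndicatorApprox (vectorMeasureOf φ x) M f)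
    (hM : MeasurableSet M) :
    Tendsto (fun n => φ (f n) x) atTop (𝓝 (indicatorCalculusFun φ hM x)) :=
  (exists_tendsto_of_isIndicatorApprox φ hM x).choose_spec f hf

/-- Finitely many vectors have a common approximating sequence. -/
theorem exists_tendsto_indicatorCalculusFun (φ : C(X, ℝ) →⋆ₐ[ℝ] (H →L[ℂ] H)) {M : Set X}
    (hM : MeasurableSet M) (s : Finset H) :
    ∃ f : ℕ → C(X, ℝ), ∀ x ∈ s, IsIndicatorApprox (vectorMeasureOf φ x) M f := by
  obtain ⟨f, hf⟩ := exists_isIndicatorApprox (∑ x ∈ s, vectorMeasureOf φ x) hM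
  exact ⟨f, fun x hx => hf.mono hM (Finset.single_le_sum (fun _ _ => Measure.zero_le _) hx)⟩

theorem norm_indicatorCalculusFun_le (φ : C(X, ℝ) →⋆ₐ[ℝ] (H →L[ℂ] H)) {M : Set X}
    (hM : MeasurableSet M) (x : H) : ‖indicatorCalculusFun φ hM x‖ ≤ ‖x‖ := by
  obtain ⟨f, hf⟩ := exists_isIndicatorApprox (vectorMeasureOf φ x) hM
  refine le_of_tendsto (hf.tendsto_calculus hM).norm (Eventually.of_forall fun n => ?_)
  refine le_of_sq_le_sq ?_ (norm_nonneg x)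
  rw [norm_sq_starAlgHom_apply, ← vectorMeasureOf_real_univ φ x]
  calc ∫ t, f n t * f n t ∂vectorMeasureOf φ x ≤ ∫ t, (1 : ℝ) ∂vectorMeasureOf φ x :=
        integral_mono (continuousMap_integrable _ (f n * f n)) (integrable_const _) fun t =>
          mul_le_one₀ (hf.mem_Icc n t).2 (hf.mem_Icc n t).1 (hf.mem_Icc n t).2
    _ = _ := by simp

/-- The indicator function of `M` in the functional calculus `φ`. -/
noncomputable def indicatorCalculus (φ : C(X, ℝ) →⋆ₐ[ℝ] (H →L[ℂ] H)) {M : Set X}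
    (hM : MeasurableSet M) : H →L[ℂ] H :=
  LinearMap.mkContinuous
    { toFun := indicatorCalculusFun φ hM
      map_add' := fun x y => by
        classical
        -- The approximating sequence depends on the vector; a common one is needed before linearity
        -- can pass to the limit.
        obtain ⟨f, hf⟩ := exists_tendsto_indicatorCalculusFun φ hM {x, y, x + y}
        refine tendsto_nhds_unique ((hf (x + y) (by simp)).tendsto_calculus hM) ?_
        simp only [map_add]
        exact ((hf x (by simp)).tendsto_calculus hM).add ((hf y (by simp)).tendsto_calculus hM)
      map_smul' := fun c x => by
        classical
        obtain ⟨f, hf⟩ := exists_tendsto_indicatorCalculusFun φ hM {x, c • x}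
        refine tendsto_nhds_unique ((hf (c • x) (by simp)).tendsto_calculus hM) ?_
        simp only [map_smul]
        exact ((hf x (by simp)).tendsto_calculus hM).const_smul c }
    1 fun x => by rw [one_mul]; exact norm_indicatorCalculusFun_le φ hM x

theorem indicatorCalculus_apply (φ : C(X, ℝ) →⋆ₐ[ℝ] (H →L[ℂ] H)) {M : Set X}
    (hM : MeasurableSet M) (x : H) :
    indicatorCalculus φ hM x = indicatorCalculusFun φ hM x := rfl

theorem re_inner_indicatorCalculus (φ : C(X, ℝ) →⋆ₐ[ℝ] (H →L[ℂ] H)) {M : Set X}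
    (hM : MeasurableSet M) (x : H) :
    (inner ℂ x (indicatorCalculus φ hM x)).re = (vectorMeasureOf φ x).real M := by
  obtain ⟨f, hf⟩ := exists_isIndicatorApprox (vectorMeasureOf φ x) hM
  have h := hf.tendsto_integral hM
  simp only [integral_vectorMeasureOf] at h
  refine tendsto_nhds_unique ?_ h
  exact (Complex.continuous_re.tendsto _).comp
    (tendsto_const_nhds.inner (hf.tendsto_calculus hM))

theorem norm_sq_indicatorCalculus (φ : C(X, ℝ) →⋆ₐ[ℝ] (H →L[ℂ] H)) {M : Set X}
    (hM : MeasurableSet M) (x : H) :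
    ‖indicatorCalculus φ hM x‖ ^ 2 = (vectorMeasureOf φ x).real M := by
  obtain ⟨f, hf⟩ := exists_isIndicatorApprox (vectorMeasureOf φ x) hM
  have h := (hf.mul_self hM).tendsto_integral hM
  refine tendsto_nhds_unique ((hf.tendsto_calculus hM).norm.pow 2) ?_
  simp only [norm_sq_starAlgHom_apply]
  exact h

theorem inner_indicatorCalculus_left (φ : C(X, ℝ) →⋆ₐ[ℝ] (H →L[ℂ] H)) {M : Set X}
    (hM : MeasurableSet M) (x y : H) :
    inner ℂ (indicatorCalculus φ hM x) y = inner ℂ x (indicatorCalculus φ hM y) := by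
  classical
  obtain ⟨f, hf⟩ := exists_tendsto_indicatorCalculusFun φ hM {x, y}
  refine tendsto_nhds_unique
    (((hf x (by simp)).tendsto_calculus hM).inner (tendsto_const_nhds (x := y))) ?_
  simp only [starAlgHom_inner_left]
  exact tendsto_const_nhds.inner ((hf y (by simp)).tendsto_calculus hM)

/-- Self-adjoint operators with the same quadratic form agree. -/
theorem eq_of_re_inner_eq {S T : H →L[ℂ] H} (hS : IsSelfAdjoint S) (hT : IsSelfAdjoint T)
    (h : ∀ x, (inner ℂ x (S x)).re = (inner ℂ x (T x)).re) : S = T := by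
  have key : ∀ x, inner ℂ ((S - T) x) x = 0 := by
    intro x
    have hs := (hS.sub hT).isSymmetric
    have h1 := hs.coe_re_inner_apply_self x
    simp only [ContinuousLinearMap.coe_coe] at h1
    rw [← h1, ← inner_re_symm]
    simp [inner_sub_right, h x]
  refine sub_eq_zero.1 (ContinuousLinearMap.ext fun x => ?_)
  have := (inner_map_self_eq_zero (S - T : H →L[ℂ] H).toLinearMap).1 key
  exact congrArg (fun f : H →ₗ[ℂ] H => f x) this

/-- The self-adjoint operators `P²` and `P` have the same quadratic form, since `‖P x‖²` and `⟨x, P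
x⟩` both equal `μ_x(M)`. -/
theorem isStarProjection_indicatorCalculus (φ : C(X, ℝ) →⋆ₐ[ℝ] (H →L[ℂ] H)) {M : Set X}
    (hM : MeasurableSet M) : IsStarProjection (indicatorCalculus φ hM) := by
  have hs : IsSelfAdjoint (indicatorCalculus φ hM) :=
    ContinuousLinearMap.isSelfAdjoint_iff_isSymmetric.2
      fun x y => inner_indicatorCalculus_left φ hM x y
  refine ⟨eq_of_re_inner_eq ?_ hs fun x => ?_, hs⟩
  · rw [isSelfAdjoint_iff, star_mul, hs.star_eq]
  · rw [mul_apply_eq_comp, ← inner_indicatorCalculus_left,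
      re_inner_indicatorCalculus, ← norm_sq_indicatorCalculus]
    exact inner_self_eq_norm_sq (𝕜 := ℂ) _

end FunctionalCalculusMeasure

/-! ### Scalar measures and moments of an abstract spectral measure. -/

namespace SpectralMeasure

variable {H : Type*} [NormedAddCommGroup H] [InnerProductSpace ℂ H] [CompleteSpace H]
variable {Ω : Type*} [MeasurableSpace Ω]

theorem ext_of_measurableSet {E F : SpectralMeasure Ω H}
    (h : ∀ M, MeasurableSet M → E.toFun M = F.toFun M) : E = F := by
  have : E.toFun = F.toFun := by
    funext M
    by_cases hM : MeasurableSet M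
    · exact h M hM
    · rw [E.not_measurable M hM, F.not_measurable M hM]
  cases E; cases F; simp_all

variable (E : SpectralMeasure Ω H)

/-- A constant sequence of empty sets gives a summable constant series, whose terms must vanish. -/
theorem map_empty : E.toFun ∅ = 0 := by
  ext x
  have h := (E.hasSum_iUnion (fun _ => ∅) (fun _ => .empty)
    (fun _ _ _ => Set.empty_disjoint _) x).summable
  exact (summable_const_iff _).1 h

theorem map_union {A B : Set Ω} (hA : MeasurableSet A) (hB : MeasurableSet B)
    (hAB : Disjoint A B) : E.toFun (A ∪ B) = E.toFun A + E.toFun B := by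
  ext x
  let M : ℕ → Set Ω := fun n => if n = 0 then A else if n = 1 then B else ∅
  have hM : ∀ n, MeasurableSet (M n) := by
    intro n
    simp only [M]
    split_ifs <;> simp [hA, hB]
  have hd : Pairwise fun m n => Disjoint (M m) (M n) := by
    intro m n hmn
    simp only [M]
    split_ifs <;> simp_all [disjoint_comm]
  have hU : ⋃ n, M n = A ∪ B := by
    ext t
    simp only [Set.mem_iUnion, Set.mem_union]
    constructor
    · rintro ⟨n, hn⟩
      simp only [M] at hn
      split_ifs at hn <;> simp_all
    · rintro (h | h)
      · exact ⟨0, by simpa [M] using h⟩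
      · exact ⟨1, by simpa [M] using h⟩
  have h1 := E.hasSum_iUnion M hM hd x
  have h2 : HasSum (fun n => E.toFun (M n) x) (∑ n ∈ {0, 1}, E.toFun (M n) x) := by
    refine hasSum_sum_of_ne_finset_zero fun n hn => ?_
    have : M n = ∅ := by
      simp only [Finset.mem_insert, Finset.mem_singleton, not_or] at hn
      simp [M, hn.1, hn.2]
    simp [this, E.map_empty]
  rw [hU] at h1
  rw [h1.unique h2]
  simp [M]

/-- The sum of the projections `P`, `Q` is again a projection, so `P Q + Q P = 0`; for idempotents
this forces `P Q = 0`. -/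
theorem mul_eq_zero_of_disjoint {A B : Set Ω} (hA : MeasurableSet A) (hB : MeasurableSet B)
    (hAB : Disjoint A B) : E.toFun A * E.toFun B = 0 := by
  have hP := (E.isStarProjection A hA).isIdempotentElem
  have hQ := (E.isStarProjection B hB).isIdempotentElem
  have hPQ := (E.isStarProjection (A ∪ B) (hA.union hB)).isIdempotentElem
  rw [E.map_union hA hB hAB] at hPQ
  have key : E.toFun A * E.toFun B + E.toFun B * E.toFun A = 0 := by
    have h := hPQ.eq
    rw [add_mul, mul_add, mul_add, hP.eq, hQ.eq] at h
    have h' : E.toFun A + E.toFun B + (E.toFun A * E.toFun B + E.toFun B * E.toFun A) =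
        E.toFun A + E.toFun B := by
      conv_rhs => rw [← h]
      abel
    simpa using h'
  have : IsAddTorsionFree (H →L[ℂ] H) := .of_isTorsionFree ℂ _
  exact hP.mul_eq_zero_of_anticommute key

theorem re_inner_eq_norm_sq {M : Set Ω} (hM : MeasurableSet M) (x : H) :
    (inner ℂ x (E.toFun M x)).re = ‖E.toFun M x‖ ^ 2 := by
  have h := E.isStarProjection M hM
  have h1 : E.toFun M x = E.toFun M (E.toFun M x) :=
    congrArg (fun T : H →L[ℂ] H => T x) h.isIdempotentElem.eq.symm
  rw [h1, ← ContinuousLinearMap.adjoint_inner_left, ← ContinuousLinearMap.star_eq_adjoint,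
    h.isSelfAdjoint.star_eq, ← h1]
  exact inner_self_eq_norm_sq (𝕜 := ℂ) _

theorem re_inner_nonneg {M : Set Ω} (hM : MeasurableSet M) (x : H) :
    0 ≤ (inner ℂ x (E.toFun M x)).re := by
  rw [E.re_inner_eq_norm_sq hM]
  positivity

/-- The scalar measure `M ↦ ⟨x, E(M) x⟩`. -/
noncomputable def scalarMeasure (x : H) : Measure Ω :=
  Measure.ofMeasurable (fun M _ => ENNReal.ofReal (inner ℂ x (E.toFun M x)).re)
    (by simp [E.map_empty]) (by
      intro M hM hd
      have h : HasSum (fun n => (inner ℂ x (E.toFun (M n) x)).re)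
          (inner ℂ x (E.toFun (⋃ n, M n) x)).re :=
        Complex.hasSum_re ((E.hasSum_iUnion M hM hd x).mapL (innerSL ℂ x))
      rw [← h.tsum_eq]
      exact ENNReal.ofReal_tsum_of_nonneg (fun n => E.re_inner_nonneg (hM n) x) h.summable)

theorem scalarMeasure_apply (x : H) {M : Set Ω} (hM : MeasurableSet M) :
    E.scalarMeasure x M = ENNReal.ofReal (inner ℂ x (E.toFun M x)).re :=
  Measure.ofMeasurable_apply M hM

theorem scalarMeasure_real (x : H) {M : Set Ω} (hM : MeasurableSet M) :
    (E.scalarMeasure x).real M = (inner ℂ x (E.toFun M x)).re := by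
  rw [Measure.real, E.scalarMeasure_apply x hM, ENNReal.toReal_ofReal (E.re_inner_nonneg hM x)]

instance (x : H) : IsFiniteMeasure (E.scalarMeasure x) :=
  ⟨by rw [E.scalarMeasure_apply x .univ]; exact ENNReal.ofReal_lt_top⟩

theorem scalarMeasure_real_univ (x : H) : (E.scalarMeasure x).real Set.univ = ‖x‖ ^ 2 := by
  rw [E.scalarMeasure_real x .univ, E.map_univ]
  exact inner_self_eq_norm_sq (𝕜 := ℂ) _

theorem eq_of_scalarMeasure_eq {E F : SpectralMeasure Ω H}
    (h : ∀ x, E.scalarMeasure x = F.scalarMeasure x) : E = F := by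
  refine ext_of_measurableSet fun M hM =>
    eq_of_re_inner_eq (E.isStarProjection M hM).isSelfAdjoint
      (F.isStarProjection M hM).isSelfAdjoint fun x => ?_
  rw [← E.scalarMeasure_real x hM, ← F.scalarMeasure_real x hM, h]

/-- Orthogonality of the pieces removes the cross terms. -/
theorem simpleSpectralIntegral_pow_succ (s : SimpleFunc Ω ℝ) (k : ℕ) :
    simpleSpectralIntegral E.toFun s ^ (k + 1) =
      ∑ c ∈ s.range, c ^ (k + 1) • E.toFun (s ⁻¹' {c}) := by
  induction k with
  | zero => simp [simpleSpectralIntegral]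
  | succ k ih =>
    rw [pow_succ, ih, simpleSpectralIntegral, Finset.sum_mul_sum]
    refine Finset.sum_congr rfl fun c hc => ?_
    rw [Finset.sum_eq_single c]
    · rw [smul_mul_smul_comm, ← pow_succ,
        (E.isStarProjection _ (s.measurableSet_preimage _)).isIdempotentElem.eq]
    · intro d _ hdc
      rw [smul_mul_smul_comm, E.mul_eq_zero_of_disjoint (s.measurableSet_preimage _)
        (s.measurableSet_preimage _), smul_zero]
      exact Disjoint.preimage _ (by simpa using hdc.symm)
    · exact fun h => absurd hc h

theorem integrable_simpleFunc (s : SimpleFunc Ω ℝ) (x : H) :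
    Integrable s (E.scalarMeasure x) :=
  SimpleFunc.integrable_of_isFiniteMeasure s

theorem re_inner_sum_smul (s : SimpleFunc Ω ℝ) (g : ℝ → ℝ) (x : H) :
    (inner ℂ x ((∑ c ∈ s.range, g c • E.toFun (s ⁻¹' {c})) x)).re =
      ∑ c ∈ s.range, g c * (E.scalarMeasure x).real (s ⁻¹' {c}) := by
  rw [sum_apply, inner_sum, Complex.re_sum]
  refine Finset.sum_congr rfl fun c _ => ?_
  rw [smul_apply, inner_smul_right_eq_smul, Complex.smul_re, smul_eq_mul,
    E.scalarMeasure_real x (s.measurableSet_preimage _)]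

theorem re_inner_simpleSpectralIntegral_pow_succ (s : SimpleFunc Ω ℝ) (k : ℕ) (x : H) :
    (inner ℂ x ((simpleSpectralIntegral E.toFun s ^ (k + 1)) x)).re =
      ∫ t, s t ^ (k + 1) ∂E.scalarMeasure x := by
  -- `SimpleFunc.map_integral` needs a function vanishing at `0`, hence the exponent `k + 1`; the
  -- zeroth moment is treated separately as a total mass.
  have h := SimpleFunc.map_integral s (fun c => c ^ (k + 1)) (E.integrable_simpleFunc s x)
    (zero_pow k.succ_ne_zero)
  rw [SimpleFunc.integral_eq_integral _ (E.integrable_simpleFunc _ x)] at h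
  rw [simpleSpectralIntegral_pow_succ, E.re_inner_sum_smul s (fun c => c ^ (k + 1))]
  simp only [SimpleFunc.map_apply, smul_eq_mul] at h
  rw [h]
  exact Finset.sum_congr rfl fun c _ => mul_comm _ _

theorem isSelfAdjoint_simpleSpectralIntegral (s : SimpleFunc Ω ℝ) :
    IsSelfAdjoint (simpleSpectralIntegral E.toFun s) := by
  rw [isSelfAdjoint_iff, simpleSpectralIntegral, star_sum]
  refine Finset.sum_congr rfl fun c _ => ?_
  rw [star_smul, star_trivial,
    (E.isStarProjection _ (s.measurableSet_preimage _)).isSelfAdjoint.star_eq]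

/-- The powers of a spectral integral are the spectral integrals of the powers. -/
theorem re_inner_pow_succ_of_hasSpectralIntegral {f : Ω → ℝ} {T : H →L[ℂ] H} {C : ℝ}
    (hC : ∀ t, |f t| ≤ C) (h : HasSpectralIntegral E.toFun f T) (k : ℕ) (x : H) :
    (inner ℂ x ((T ^ (k + 1)) x)).re = ∫ t, f t ^ (k + 1) ∂E.scalarMeasure x := by
  obtain ⟨⟨s, hs⟩, hT⟩ := h
  have h1 : Tendsto (fun n => (inner ℂ x ((simpleSpectralIntegral E.toFun (s n) ^ (k + 1)) x)).re)
      atTop (𝓝 (inner ℂ x ((T ^ (k + 1)) x)).re) := by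
    have hc : Continuous fun S : H →L[ℂ] H => (inner ℂ x ((S ^ (k + 1)) x)).re := by fun_prop
    exact (hc.tendsto T).comp (hT s hs)
  refine tendsto_nhds_unique h1 ?_
  simp only [re_inner_simpleSpectralIntegral_pow_succ]
  -- Eventually `s n` is within `1` of `f`, so its values are bounded by `C + 1`.
  refine tendsto_integral_filter_of_dominated_convergence (fun _ => (C + 1) ^ (k + 1)) ?_ ?_
    (integrable_const _) ?_
  · exact Eventually.of_forall fun n => ((s n).measurable.pow_const _).aestronglyMeasurable
  · filter_upwards [Metric.tendstoUniformly_iff.1 hs 1 one_pos] with n hn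
    refine ae_of_all _ fun t => ?_
    rw [norm_pow]
    refine pow_le_pow_left₀ (norm_nonneg _) ?_ _
    have h2 := hn t
    rw [Real.dist_eq, abs_lt] at h2
    have h3 := abs_le.1 (hC t)
    rw [Real.norm_eq_abs, abs_le]
    constructor <;> linarith
  · exact ae_of_all _ fun t => (hs.tendsto_at t).pow _

end SpectralMeasure

/-- Finite measures on a compact set of real numbers are determined by their moments. -/
theorem measure_eq_of_moments_eq {K : Set ℝ} [CompactSpace K] {μ ν : Measure K}
    [IsFiniteMeasure μ] [IsFiniteMeasure ν]
    (h : ∀ k : ℕ, ∫ t, (t : ℝ) ^ k ∂μ = ∫ t, (t : ℝ) ^ k ∂ν) : μ = ν := by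
  have hcont : ∀ ρ : Measure K, IsFiniteMeasure ρ →
      Continuous fun f : C(K, ℝ) => ∫ t, f t ∂ρ := by
    intro ρ _
    refine (LipschitzWith.of_dist_le_mul (K := (ρ.real Set.univ).toNNReal)
      fun f g => ?_).continuous
    rw [Real.dist_eq, ← integral_sub (continuousMap_integrable ρ f) (continuousMap_integrable ρ g),
      Real.coe_toNNReal _ measureReal_nonneg, mul_comm, dist_eq_norm]
    exact norm_integral_le_of_norm_le_const (ae_of_all _ fun t => (f - g).norm_coe_le_norm t)
  have hpoly : ∀ f ∈ polynomialFunctions K, ∫ t, f t ∂μ = ∫ t, f t ∂ν := by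
    rintro _ ⟨p, -, rfl⟩
    have hp : ∀ ρ : Measure K, IsFiniteMeasure ρ →
        ∫ t, (Polynomial.toContinuousMapOnAlgHom K p) t ∂ρ =
          ∑ i ∈ Finset.range (p.natDegree + 1), p.coeff i * ∫ t, (t : ℝ) ^ i ∂ρ := by
      intro ρ _
      have : ∀ t : K, (Polynomial.toContinuousMapOnAlgHom K p) t =
          ∑ i ∈ Finset.range (p.natDegree + 1), p.coeff i * (t : ℝ) ^ i := fun t =>
        Polynomial.eval_eq_sum_range _
      simp only [this]
      rw [integral_finsetSum]
      · simp only [integral_const_mul]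
      · intro i _
        exact (continuousMap_integrable ρ ⟨fun t : K => (t : ℝ) ^ i, by fun_prop⟩).const_mul _
    change ∫ t, (Polynomial.toContinuousMapOnAlgHom K p) t ∂μ =
      ∫ t, (Polynomial.toContinuousMapOnAlgHom K p) t ∂ν
    rw [hp μ inferInstance, hp ν inferInstance]
    simp only [h]
  have hall : ∀ f : C(K, ℝ), ∫ t, f t ∂μ = ∫ t, f t ∂ν := by
    intro f
    have hf : f ∈ (polynomialFunctions K).topologicalClosure := by
      rw [ContinuousMap.subalgebra_topologicalClosure_eq_top_of_separatesPoints _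
        (polynomialFunctions_separatesPoints K)]
      exact Algebra.mem_top
    -- The two integrals agree on a closed set of functions containing the polynomials, which are
    -- dense by Stone–Weierstrass.
    exact closure_minimal (s := (polynomialFunctions K : Set C(K, ℝ))) hpoly
      (isClosed_eq (hcont μ inferInstance) (hcont ν inferInstance)) hf
  exact ext_of_forall_integral_eq_of_IsFiniteMeasure fun f => hall f.toContinuousMap

/-! ### Uniqueness of the spectral measure. -/

section

variable {H : Type*} [NormedAddCommGroup H] [InnerProductSpace ℂ H] [CompleteSpace H]

theorem isSpectralMeasureOf_unique {T : H →L[ℂ] H} {E F : SpectralMeasure (spectrum ℝ T) H}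
    (hE : IsSpectralMeasureOf T E) (hF : IsSpectralMeasureOf T F) : E = F := by
  have : CompactSpace (spectrum ℝ T) := isCompact_iff_compactSpace.1 (spectrum.isCompact T)
  have hC : ∀ t : spectrum ℝ T, |(t : ℝ)| ≤ ‖T‖ * ‖(1 : H →L[ℂ] H)‖ :=
    fun t => spectrum.norm_le_norm_mul_of_mem t.2
  refine SpectralMeasure.eq_of_scalarMeasure_eq fun x => measure_eq_of_moments_eq fun k => ?_
  cases k with
  | zero =>
    simp only [pow_zero, integral_const, smul_eq_mul, mul_one,
      SpectralMeasure.scalarMeasure_real_univ]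
  | succ k =>
    rw [← E.re_inner_pow_succ_of_hasSpectralIntegral hC hE,
      ← F.re_inner_pow_succ_of_hasSpectralIntegral hC hF]

end

theorem exists_simpleFunc_tendstoUniformly {Ω : Type*} [MeasurableSpace Ω] {f : Ω → ℝ}
    (hf : Measurable f) {C : ℝ} (hC : ∀ t, |f t| ≤ C) :
    ∃ s : ℕ → SimpleFunc Ω ℝ, TendstoUniformly (fun n ω => s n ω) f atTop := by
  -- Values are rounded down to the grid of mesh `1 / (n + 1)`; boundedness of `f` leaves finitely
  -- many of them.
  let g : ℕ → Ω → ℝ := fun n t => (⌊((n : ℝ) + 1) * f t⌋ : ℝ) / ((n : ℝ) + 1)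
  have hg : ∀ n, Measurable (g n) := fun n =>
    ((measurable_from_top (f := fun z : ℤ => (z : ℝ))).comp
      (hf.const_mul _).floor).div_const _
  have hfin : ∀ n, (Set.range (g n)).Finite := by
    intro n
    refine ((Set.finite_Icc ⌊((n : ℝ) + 1) * (-C)⌋ ⌊((n : ℝ) + 1) * C⌋).image
      fun z : ℤ => (z : ℝ) / ((n : ℝ) + 1)).subset ?_
    rintro _ ⟨t, rfl⟩
    have h := abs_le.1 (hC t)
    refine ⟨_, ⟨Int.floor_mono ?_, Int.floor_mono ?_⟩, rfl⟩
    · exact mul_le_mul_of_nonneg_left h.1 (by positivity)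
    · exact mul_le_mul_of_nonneg_left h.2 (by positivity)
  refine ⟨fun n => ⟨g n, fun x => hg n (measurableSet_singleton x), hfin n⟩, ?_⟩
  rw [Metric.tendstoUniformly_iff]
  intro ε hε
  have h1 := (tendsto_one_div_add_atTop_nhds_zero_nat (𝕜 := ℝ)).eventually (gt_mem_nhds hε)
  filter_upwards [h1] with n hn t
  refine lt_of_le_of_lt ?_ hn
  change |f t - (⌊((n : ℝ) + 1) * f t⌋ : ℝ) / ((n : ℝ) + 1)| ≤ _
  have hpos : (0 : ℝ) < (n : ℝ) + 1 := by positivity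
  have e : f t - (⌊((n : ℝ) + 1) * f t⌋ : ℝ) / ((n : ℝ) + 1) =
      Int.fract (((n : ℝ) + 1) * f t) / ((n : ℝ) + 1) := by
    rw [Int.fract]
    field_simp
  rw [e, abs_of_nonneg (div_nonneg (Int.fract_nonneg _) hpos.le)]
  exact div_le_div_of_nonneg_right (Int.fract_lt_one _).le hpos.le

/-! ### Existence of the spectral measure, and commutation with real linear operators. -/

section

variable {H : Type*} [NormedAddCommGroup H] [InnerProductSpace ℂ H] [CompleteSpace H]

/-- The norm of a self-adjoint operator is the supremum of its Rayleigh quotients. This upgrades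
estimates of quadratic forms, which are all that scalar measures give, to norm estimates. -/
theorem IsSelfAdjoint.norm_le_of_abs_re_inner_le {T : H →L[ℂ] H} (hT : IsSelfAdjoint T) {c : ℝ}
    (hc : 0 ≤ c) (h : ∀ x, |(inner ℂ x (T x)).re| ≤ c * ‖x‖ ^ 2) : ‖T‖ ≤ c := by
  rw [ContinuousLinearMap.norm_eq_iSup_rayleighQuotient T hT.isSymmetric]
  refine ciSup_le fun x => ?_
  rw [ContinuousLinearMap.rayleighQuotient, ContinuousLinearMap.reApplyInnerSelf_apply, abs_div,
    abs_of_nonneg (sq_nonneg ‖x‖), ← inner_re_symm]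
  exact div_le_of_le_mul₀ (sq_nonneg _) hc (h x)

section Calculus

variable {X : Type*} [MetricSpace X] [CompactSpace X] [MeasurableSpace X] [BorelSpace X]

theorem indicatorCalculus_add_eq_of_disjoint (φ : C(X, ℝ) →⋆ₐ[ℝ] (H →L[ℂ] H)) {A B U : Set X}
    (hA : MeasurableSet A) (hB : MeasurableSet B) (hU : MeasurableSet U) (hAB : Disjoint A B)
    (h : A ∪ B = U) :
    indicatorCalculus φ hA + indicatorCalculus φ hB = indicatorCalculus φ hU := by
  refine eq_of_re_inner_eq ((isStarProjection_indicatorCalculus φ hA).isSelfAdjoint.add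
    (isStarProjection_indicatorCalculus φ hB).isSelfAdjoint)
    (isStarProjection_indicatorCalculus φ hU).isSelfAdjoint fun x => ?_
  rw [add_apply, inner_add_right, Complex.add_re, re_inner_indicatorCalculus,
    re_inner_indicatorCalculus, re_inner_indicatorCalculus, ← h, measureReal_union hAB hB]

theorem hasSum_indicatorCalculus (φ : C(X, ℝ) →⋆ₐ[ℝ] (H →L[ℂ] H)) {M : ℕ → Set X}
    (hM : ∀ n, MeasurableSet (M n)) (hd : Pairwise fun m n => Disjoint (M m) (M n)) (x : H) :
    HasSum (fun n => indicatorCalculus φ (hM n) x)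
      (indicatorCalculus φ (MeasurableSet.iUnion hM) x) := by
  classical
  set μ := vectorMeasureOf φ x
  have hfin : ∀ s : Finset ℕ, MeasurableSet (⋃ n ∈ s, M n) := fun s =>
    s.measurableSet_biUnion fun n _ => hM n
  have hsum : ∀ s : Finset ℕ,
      ∑ n ∈ s, indicatorCalculus φ (hM n) = indicatorCalculus φ (hfin s) := by
    intro s
    refine eq_of_re_inner_eq ?_ (isStarProjection_indicatorCalculus φ _).isSelfAdjoint fun y => ?_
    · rw [isSelfAdjoint_iff, star_sum]
      exact Finset.sum_congr rfl fun n _ =>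
        (isStarProjection_indicatorCalculus φ (hM n)).isSelfAdjoint.star_eq
    · rw [sum_apply, inner_sum, Complex.re_sum, re_inner_indicatorCalculus,
        measureReal_biUnion_finset (fun i _ j _ hij => hd hij) fun n _ => hM n]
      exact Finset.sum_congr rfl fun n _ => re_inner_indicatorCalculus φ (hM n) y
  have hreal : HasSum (fun n => μ.real (M n)) (μ.real (⋃ n, M n)) := by
    have h := measure_iUnion (μ := μ) hd hM
    rw [Measure.real, h, ENNReal.tsum_toReal_eq fun n => measure_ne_top _ _]
    exact ENNReal.hasSum_toReal (by rw [← h]; exact measure_ne_top _ _)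
  -- The error of a partial sum is minus the projection of the remaining set, so its squared norm is
  -- the `μ_x`-measure of that set.
  have hdiff : ∀ s : Finset ℕ, ‖∑ n ∈ s, indicatorCalculus φ (hM n) x -
      indicatorCalculus φ (MeasurableSet.iUnion hM) x‖ ^ 2 =
        μ.real (⋃ n, M n) - ∑ n ∈ s, μ.real (M n) := by
    intro s
    have hsub : ⋃ n ∈ s, M n ⊆ ⋃ n, M n := Set.iUnion₂_subset_iUnion _ _
    have h := indicatorCalculus_add_eq_of_disjoint φ (hfin s)
      ((MeasurableSet.iUnion hM).diff (hfin s)) (MeasurableSet.iUnion hM)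
      Set.disjoint_sdiff_right (Set.union_sdiff_cancel hsub)
    rw [← sum_apply, hsum, ← h, add_apply, sub_add_cancel_left, norm_neg,
      norm_sq_indicatorCalculus, measureReal_sdiff hsub (hfin s),
      measureReal_biUnion_finset (fun i _ j _ hij => hd hij) fun n _ => hM n]
  have h0 : Tendsto (fun s : Finset ℕ => ‖∑ n ∈ s, indicatorCalculus φ (hM n) x -
      indicatorCalculus φ (MeasurableSet.iUnion hM) x‖ ^ 2) atTop (𝓝 0) := by
    simp only [hdiff]
    have h := Tendsto.const_sub (μ.real (⋃ n, M n)) hreal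
    simpa using h
  refine tendsto_iff_norm_sub_tendsto_zero.2 ?_
  simpa using h0.sqrt

open Classical in
/-- The spectral measure of a continuous functional calculus. -/
noncomputable def spectralMeasureOfCalculus (φ : C(X, ℝ) →⋆ₐ[ℝ] (H →L[ℂ] H)) :
    SpectralMeasure X H where
  toFun M := if hM : MeasurableSet M then indicatorCalculus φ hM else 0
  isStarProjection M hM := by
    rw [dif_pos hM]
    exact isStarProjection_indicatorCalculus φ hM
  map_univ := by
    rw [dif_pos MeasurableSet.univ]
    refine eq_of_re_inner_eq (isStarProjection_indicatorCalculus φ _).isSelfAdjoint (.one _)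
      fun x => ?_
    rw [re_inner_indicatorCalculus, vectorMeasureOf_real_univ]
    exact (inner_self_eq_norm_sq (𝕜 := ℂ) _).symm
  hasSum_iUnion M hM hd x := by
    rw [dif_pos (MeasurableSet.iUnion hM)]
    simp only [dif_pos (hM _)]
    exact hasSum_indicatorCalculus φ hM hd x
  not_measurable M hM := dif_neg hM

theorem spectralMeasureOfCalculus_apply (φ : C(X, ℝ) →⋆ₐ[ℝ] (H →L[ℂ] H)) {M : Set X}
    (hM : MeasurableSet M) :
    (spectralMeasureOfCalculus φ).toFun M = indicatorCalculus φ hM :=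
  dif_pos hM

theorem scalarMeasure_spectralMeasureOfCalculus (φ : C(X, ℝ) →⋆ₐ[ℝ] (H →L[ℂ] H)) (x : H) :
    (spectralMeasureOfCalculus φ).scalarMeasure x = vectorMeasureOf φ x := by
  refine Measure.ext fun M hM => ?_
  rw [SpectralMeasure.scalarMeasure_apply _ x hM, spectralMeasureOfCalculus_apply φ hM,
    re_inner_indicatorCalculus, ofReal_measureReal]

theorem hasSpectralIntegral_spectralMeasureOfCalculus (φ : C(X, ℝ) →⋆ₐ[ℝ] (H →L[ℂ] H))
    (f : C(X, ℝ)) : HasSpectralIntegral (spectralMeasureOfCalculus φ).toFun f (φ f) := by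
  set E := spectralMeasureOfCalculus φ
  refine ⟨exists_simpleFunc_tendstoUniformly f.continuous.measurable
    (C := ‖f‖) fun t => f.norm_coe_le_norm t, fun s hs => ?_⟩
  rw [Metric.tendsto_atTop]
  intro ε hε
  obtain ⟨N, hN⟩ := eventually_atTop.1 (Metric.tendstoUniformly_iff.1 hs (ε / 2) (half_pos hε))
  refine ⟨N, fun n hn => lt_of_le_of_lt ?_ (half_lt_self hε)⟩
  rw [dist_eq_norm]
  have hsa : IsSelfAdjoint (φ f) := by rw [isSelfAdjoint_iff, ← map_star, star_trivial]
  -- The quadratic form of the difference is `∫ (s n - f) dμ_x`, at most `ε / 2` times the total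
  -- mass `‖x‖²`.
  refine ((E.isSelfAdjoint_simpleSpectralIntegral (s n)).sub hsa).norm_le_of_abs_re_inner_le
    (half_pos hε).le fun x => ?_
  have h1 := E.re_inner_simpleSpectralIntegral_pow_succ (s n) 0 x
  simp only [zero_add, pow_one] at h1
  rw [sub_apply, inner_sub_right, Complex.sub_re, h1,
    ← integral_vectorMeasureOf, ← scalarMeasure_spectralMeasureOfCalculus,
    ← integral_sub (E.integrable_simpleFunc _ x) (continuousMap_integrable _ f),
    ← Real.norm_eq_abs, ← E.scalarMeasure_real_univ]
  refine norm_integral_le_of_norm_le_const (ae_of_all _ fun t => ?_)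
  rw [← dist_eq_norm, dist_comm]
  exact (hN n hn t).le

end Calculus

/-- The functions whose calculus commutes with `τ` form a closed real subalgebra containing the
constants and the identity. Only real constants occur, so real linearity of `τ` suffices. -/
theorem cfcHom_apply_comm_of_real {T : H →L[ℂ] H} (hT : IsSelfAdjoint T) {τ : H →L[ℝ] H}
    (hτ : ∀ x, τ (T x) = T (τ x)) (f : C(spectrum ℝ T, ℝ)) (x : H) :
    τ (cfcHom (R := ℝ) hT f x) = cfcHom (R := ℝ) hT f (τ x) := by
  have : CompactSpace (spectrum ℝ T) := isCompact_iff_compactSpace.1 (spectrum.isCompact T)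
  have hid : ∀ x, τ (cfcHom (R := ℝ) hT (.restrict _ <| .id ℝ) x) =
      cfcHom (R := ℝ) hT (.restrict _ <| .id ℝ) (τ x) := by
    rw [cfcHom_id]
    exact hτ
  induction f using ContinuousMap.induction_on_of_compact generalizing x with
  | const r =>
    have h : cfcHom (R := ℝ) hT (.const _ r) = algebraMap ℝ (H →L[ℂ] H) r :=
      AlgHomClass.commutes (cfcHom (R := ℝ) hT) r
    simp [h, Algebra.algebraMap_eq_smul_one]
  | id => exact hid x
  | star_id => rw [star_trivial]; exact hid x
  | add f g hf hg => simp only [map_add, add_apply, hf, hg]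
  | mul f g hf hg => simp only [map_mul, mul_apply_eq_comp, hf, hg]
  | frequently f h =>
    have hc : Continuous (cfcHom (R := ℝ) hT) := cfcHom_continuous hT
    have hcl : IsClosed {g : C(spectrum ℝ T, ℝ) |
        ∀ x, τ (cfcHom (R := ℝ) hT g x) = cfcHom (R := ℝ) hT g (τ x)} := by
      simp only [Set.ofPred_forall]
      exact isClosed_iInter fun x => isClosed_eq (by fun_prop) (by fun_prop)
    exact h.mem_of_closed hcl x

theorem exists_isSpectralMeasureOf {T : H →L[ℂ] H} (hT : IsSelfAdjoint T) :
    ∃ E : SpectralMeasure (spectrum ℝ T) H, IsSpectralMeasureOf T E ∧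
      ∀ τ : H →L[ℝ] H, (∀ x, τ (T x) = T (τ x)) → ∀ M, MeasurableSet M →
        ∀ x, τ (E.toFun M x) = E.toFun M (τ x) := by
  classical
  have : CompactSpace (spectrum ℝ T) := isCompact_iff_compactSpace.1 (spectrum.isCompact T)
  refine ⟨spectralMeasureOfCalculus (cfcHom (R := ℝ) hT), ?_, fun τ hτ M hM x => ?_⟩
  · have h := hasSpectralIntegral_spectralMeasureOfCalculus (cfcHom (R := ℝ) hT)
      (.restrict _ <| .id ℝ)
    rw [cfcHom_id] at h
    exact h
  · rw [spectralMeasureOfCalculus_apply _ hM, indicatorCalculus_apply, indicatorCalculus_apply]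
    -- One sequence approximates the indicator for both `x` and `τ x`, so the commutation with `φ (f
    -- n)` survives the limit.
    obtain ⟨f, hf⟩ := exists_tendsto_indicatorCalculusFun (cfcHom (R := ℝ) hT) hM {x, τ x}
    refine tendsto_nhds_unique ((τ.continuous.tendsto _).comp
      ((hf x (by simp)).tendsto_calculus hM)) ?_
    simp only [Function.comp_def, cfcHom_apply_comm_of_real hT hτ]
    exact (hf (τ x) (by simp)).tendsto_calculus hM

theorem IsSpectralMeasureOf.apply_comm_of_real {T : H →L[ℂ] H} (hT : IsSelfAdjoint T)
    {E : SpectralMeasure (spectrum ℝ T) H} (hE : IsSpectralMeasureOf T E) {τ : H →L[ℝ] H}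
    (hτ : ∀ x, τ (T x) = T (τ x)) {M : Set (spectrum ℝ T)} (hM : MeasurableSet M) (x : H) :
    τ (E.toFun M x) = E.toFun M (τ x) := by
  obtain ⟨F, hF, h⟩ := exists_isSpectralMeasureOf hT
  rw [isSpectralMeasureOf_unique hE hF]
  exact h τ hτ M hM x

end

/-! ### Unitary conjugations on an arbitrary Hilbert space. -/

section ConjugationExistence

variable {H : Type*} [NormedAddCommGroup H] [InnerProductSpace ℂ H] [CompleteSpace H]

/-- Every complex Hilbert space has a unitary conjugation. -/
theorem exists_isUnitaryConjugation (K : Type*) [NormedAddCommGroup K] [InnerProductSpace ℂ K]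
    [CompleteSpace K] : ∃ J : K →L[ℝ] K, IsUnitaryConjugation J := by
  obtain ⟨w, b, -⟩ := exists_hilbertBasis ℂ K
  have hsmul : ∀ (r : ℝ) (x : K), r • x = (r : ℂ) • x := fun r x => (Complex.coe_smul r x).symm
  -- Complex conjugation of the coordinates in a Hilbert basis.
  let J : K →ₗ[ℝ] K :=
    { toFun := fun x => b.repr.symm (star (b.repr x))
      map_add' := fun x y => by simp
      map_smul' := fun r x => by
        simp only [hsmul, RingHom.id_apply, map_smul, star_smul]
        simp }
  refine ⟨J.mkContinuous 1 fun x => ?_, ?_, ?_, ?_⟩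
  · change ‖b.repr.symm (star (b.repr x))‖ ≤ _
    simp
  · intro x
    change b.repr.symm (star (b.repr (Complex.I • x))) =
      -(Complex.I • b.repr.symm (star (b.repr x)))
    simp [star_smul]
  · intro x
    change b.repr.symm (star (b.repr (b.repr.symm (star (b.repr x))))) = x
    simp
  · intro x
    change ‖b.repr.symm (star (b.repr x))‖ = _
    simp

end ConjugationExistence

/-! ### The modulus and the polar decomposition. -/

section Modulus

variable {H : Type*} [NormedAddCommGroup H] [InnerProductSpace ℂ H] [CompleteSpace H]

theorem IsAntilinear.adjointMulSelf_apply {A : H →L[ℝ] H} (hA : IsAntilinear A) (x : H) :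
    hA.adjointMulSelf x = realAdjoint A (A x) := rfl

/-- Replacing `y` by `i y` recovers the imaginary parts, because `T` is complex linear. -/
theorem isSelfAdjoint_of_re_inner_eq {T : H →L[ℂ] H}
    (h : ∀ x y, (inner ℂ (T x) y).re = (inner ℂ x (T y)).re) : IsSelfAdjoint T := by
  refine ContinuousLinearMap.isSelfAdjoint_iff_isSymmetric.2 fun x y => Complex.ext (h x y) ?_
  have h2 := h x (Complex.I • y)
  simp only [map_smul, inner_smul_right, Complex.mul_re, Complex.I_re, Complex.I_im, zero_mul,
    one_mul, zero_sub, neg_inj] at h2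
  exact h2

theorem IsAntilinear.adjointMulSelf_nonneg {A : H →L[ℝ] H} (hA : IsAntilinear A) :
    0 ≤ hA.adjointMulSelf := by
  rw [ContinuousLinearMap.nonneg_iff_isPositive]
  refine ⟨ContinuousLinearMap.isSelfAdjoint_iff_isSymmetric.1
    (isSelfAdjoint_of_re_inner_eq fun x y => ?_), fun x => ?_⟩
  · rw [hA.adjointMulSelf_apply, hA.adjointMulSelf_apply, ← re_inner_realAdjoint, re_inner_comm,
      ← re_inner_realAdjoint, re_inner_comm]
  · change 0 ≤ (inner ℂ (hA.adjointMulSelf x) x).re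
    rw [re_inner_comm, hA.adjointMulSelf_apply, ← re_inner_realAdjoint]
    exact inner_self_nonneg (𝕜 := ℂ)

theorem IsAntilinear.modulus_nonneg {A : H →L[ℝ] H} (hA : IsAntilinear A) :
    0 ≤ hA.modulus := CFC.sqrt_nonneg _

theorem IsAntilinear.modulus_isSelfAdjoint {A : H →L[ℝ] H} (hA : IsAntilinear A) :
    IsSelfAdjoint hA.modulus := .of_nonneg hA.modulus_nonneg

theorem IsAntilinear.modulus_mul_self {A : H →L[ℝ] H} (hA : IsAntilinear A) :
    hA.modulus * hA.modulus = hA.adjointMulSelf :=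
  CFC.sqrt_mul_sqrt_self _ hA.adjointMulSelf_nonneg

theorem IsAntilinear.modulus_modulus {A : H →L[ℝ] H} (hA : IsAntilinear A) (x : H) :
    hA.modulus (hA.modulus x) = realAdjoint A (A x) := by
  rw [← hA.adjointMulSelf_apply, ← hA.modulus_mul_self, mul_apply_eq_comp]

theorem IsAntilinear.inner_modulus_left {A : H →L[ℝ] H} (hA : IsAntilinear A) (x y : H) :
    inner ℂ (hA.modulus x) y = inner ℂ x (hA.modulus y) :=
  hA.modulus_isSelfAdjoint.isSymmetric x y

theorem IsAntilinear.norm_modulus_apply {A : H →L[ℝ] H} (hA : IsAntilinear A) (x : H) :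
    ‖hA.modulus x‖ = ‖A x‖ := by
  rw [← sq_eq_sq₀ (norm_nonneg _) (norm_nonneg _), ← inner_self_eq_norm_sq (𝕜 := ℂ),
    ← inner_self_eq_norm_sq (𝕜 := ℂ), hA.inner_modulus_left, hA.modulus_modulus]
  exact (re_inner_realAdjoint A x (A x)).symm

/-- Real linear operators that commute with `A* A` commute with `|A|`. -/
theorem IsAntilinear.modulus_apply_comm {A : H →L[ℝ] H} (hA : IsAntilinear A) {τ : H →L[ℝ] H}
    (hτ : ∀ x, τ (hA.adjointMulSelf x) = hA.adjointMulSelf (τ x)) (x : H) :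
    τ (hA.modulus x) = hA.modulus (τ x) := by
  have hsa : IsSelfAdjoint hA.adjointMulSelf := .of_nonneg hA.adjointMulSelf_nonneg
  rw [IsAntilinear.modulus, CFC.sqrt_eq_real_sqrt _ hA.adjointMulSelf_nonneg, cfcₙ_eq_cfc,
    cfc_apply Real.sqrt hA.adjointMulSelf hsa Real.continuous_sqrt.continuousOn]
  exact cfcHom_apply_comm_of_real hsa hτ _ x

variable {A : H →L[ℝ] H}

theorem IsRealSelfAdjoint.re_inner_left (h : IsRealSelfAdjoint A) (x y : H) :
    (inner ℂ (A x) y).re = (inner ℂ x (A y)).re := by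
  conv_rhs => rw [h]
  exact re_inner_realAdjoint A x y

theorem isRealSelfAdjoint_of_re_inner_eq
    (h : ∀ x y, (inner ℂ (A x) y).re = (inner ℂ x (A y)).re) : IsRealSelfAdjoint A := by
  let _ : InnerProductSpace ℝ H := InnerProductSpace.complexToReal
  refine ContinuousLinearMap.ext fun y => ext_inner_left ℝ fun x => ?_
  change (inner ℂ x (A y)).re = (inner ℂ x (realAdjoint A y)).re
  rw [← h, re_inner_realAdjoint]

theorem IsAntilinear.modulus_modulus_of_selfAdjoint (hA : IsAntilinear A)
    (h : IsRealSelfAdjoint A) (x : H) : hA.modulus (hA.modulus x) = A (A x) := by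
  rw [hA.modulus_modulus, ← h]

theorem IsAntilinear.apply_modulus_comm (hA : IsAntilinear A) (h : IsRealSelfAdjoint A) (x : H) :
    A (hA.modulus x) = hA.modulus (A x) := by
  refine hA.modulus_apply_comm (fun y => ?_) x
  rw [hA.adjointMulSelf_apply, hA.adjointMulSelf_apply, ← h]

/-- The isometric part of the polar decomposition, extended by zero to the kernel of `|A|`. -/
theorem IsAntilinear.exists_partial_isometry (hA : IsAntilinear A) :
    ∃ V : H →L[ℝ] H, (∀ x, V (hA.modulus x) = A x) ∧
      ∀ x ∈ hA.modulus.range.topologicalClosureᗮ, V x = 0 := by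
  set M := hA.modulus.range.topologicalClosure
  let e : H →ₗ[ℝ] M :=
    ((hA.modulus.toLinearMap.codRestrict M fun x =>
      hA.modulus.range.le_topologicalClosure ⟨x, rfl⟩).restrictScalars ℝ)
  have he : ∀ x, (e x : H) = hA.modulus x := fun x => rfl
  have hd : DenseRange e := by
    intro x
    rw [Metric.mem_closure_iff]
    intro ε hε
    obtain ⟨_, ⟨y, rfl⟩, hy⟩ := Metric.mem_closure_iff.1 x.2 ε hε
    exact ⟨e y, ⟨y, rfl⟩, hy⟩
  -- The equality `‖A x‖ = ‖|A| x‖` makes `|A| x ↦ A x` well defined and bounded, so it extends from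
  -- the dense range of `e` to `M`.
  have hb : ∀ x, ‖A.toLinearMap x‖ ≤ 1 * ‖e x‖ := fun x => by
    rw [one_mul, Submodule.coe_norm, he, hA.norm_modulus_apply]; rfl
  refine ⟨(A.toLinearMap.extendOfNorm e).comp
    (M.orthogonalProjectionOnto.restrictScalars ℝ), fun x => ?_, fun x hx => ?_⟩
  · have h1 : M.orthogonalProjectionOnto (hA.modulus x) = e x := by
      rw [← he]; exact Submodule.orthogonalProjectionOnto_mem_subspace_eq_self _
    change A.toLinearMap.extendOfNorm e (M.orthogonalProjectionOnto (hA.modulus x)) = A x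
    rw [h1, LinearMap.extendOfNorm_eq hd ⟨1, hb⟩]; rfl
  · change A.toLinearMap.extendOfNorm e (M.orthogonalProjectionOnto x) = 0
    rw [Submodule.orthogonalProjectionOnto_apply_of_mem_orthogonal hx, map_zero]

/-- The conjugation is the partial isometry `V` on the closure `M` of the range of `|A|`, plus an
arbitrary conjugation `J` of `Mᗮ`, where both `A` and `|A|` vanish. Identities for `V` are checked
on the range of `|A|` and extended by continuity. -/
theorem IsAntilinear.exists_isPolarConjugation (hA : IsAntilinear A) (h : IsRealSelfAdjoint A) :
    ∃ τ : H →L[ℝ] H, IsPolarConjugation hA τ := by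
  obtain ⟨V, hVP, hV0⟩ := hA.exists_partial_isometry
  set P := hA.modulus with hP
  set M := P.range.topologicalClosure
  obtain ⟨J, hJ⟩ := exists_isUnitaryConjugation (Mᗮ : Submodule ℂ H)
  have hPM : ∀ x, P x ∈ M := fun x => P.range.le_topologicalClosure ⟨x, rfl⟩
  have hP0 : ∀ x ∈ Mᗮ, P x = 0 := by
    intro x hx
    refine inner_self_eq_zero (𝕜 := ℂ).1 ?_
    exact (hA.inner_modulus_left (P x) x).symm.trans
      ((Submodule.mem_orthogonal M x).1 hx _ (hPM _))
  have hA0 : ∀ x ∈ Mᗮ, A x = 0 := fun x hx => by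
    rw [← norm_eq_zero, ← hA.norm_modulus_apply, ← hP, hP0 x hx, norm_zero]
  have hdecomp : ∀ x : H, ∃ m ∈ M, ∃ n ∈ Mᗮ, x = m + n := fun x =>
    ⟨_, M.starProjection_apply_mem x, _, M.sub_starProjection_mem_orthogonal x, by abel⟩
  have hind : ∀ S T : H →L[ℝ] H, (∀ x, S (P x) = T (P x)) → ∀ x ∈ M, S x = T x := by
    intro S T hST x hx
    refine closure_minimal (s := (P.range : Set H)) (t := {x | S x = T x}) ?_
      (isClosed_eq S.continuous T.continuous) hx
    rintro _ ⟨y, rfl⟩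
    exact hST y
  have hext : ∀ S T : H →L[ℝ] H, (∀ x, S (P x) = T (P x)) → (∀ x ∈ Mᗮ, S x = T x) →
      ∀ x, S x = T x := by
    intro S T hST hST0 x
    obtain ⟨m, hm, n, hn, rfl⟩ := hdecomp x
    rw [map_add, map_add, hind S T hST m hm, hST0 n hn]
  -- On the range of `P`, `V A P = V P A = A A = P P`. Then `V V P = V A = P`, so `V` is an
  -- involution on `M`.
  have hVA : ∀ x, V (A x) = P x := by
    refine hext (V * A) (P.restrictScalars ℝ) (fun x => ?_) fun x hx => ?_
    · change V (A (P x)) = P (P x)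
      rw [hA.apply_modulus_comm h, hVP, hA.modulus_modulus_of_selfAdjoint h]
    · change V (A x) = P x
      rw [hA0 x hx, hP0 x hx, map_zero]
  have hVV : ∀ x ∈ M, V (V x) = x := by
    refine hind (V * V) 1 fun x => ?_
    change V (V (P x)) = P x
    rw [hVP, hVA]
  have hPV : ∀ x, P (V x) = V (P x) := by
    refine hext (P.restrictScalars ℝ * V) (V * P.restrictScalars ℝ) (fun x => ?_) fun x hx => ?_
    · change P (V (P x)) = V (P (P x))
      rw [hVP, hVP, hA.apply_modulus_comm h]
    · change P (V x) = V (P x)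
      rw [hV0 x hx, hP0 x hx, map_zero, map_zero]
  have hVM : ∀ x ∈ M, V x ∈ M := by
    intro x hx
    refine closure_minimal (s := (P.range : Set H)) (t := V ⁻¹' M) ?_
      (P.range.isClosed_topologicalClosure.preimage V.continuous) hx
    rintro _ ⟨y, rfl⟩
    change V (P y) ∈ M
    rw [← hPV]
    exact hPM _
  have hVnorm : ∀ x ∈ M, ‖V x‖ = ‖x‖ := by
    intro x hx
    refine closure_minimal (s := (P.range : Set H)) (t := {x | ‖V x‖ = ‖x‖}) ?_
      (isClosed_eq V.continuous.norm continuous_norm) hx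
    rintro _ ⟨y, rfl⟩
    change ‖V (P y)‖ = ‖P y‖
    rw [hVP, hA.norm_modulus_apply]
  have hVI : ∀ x ∈ M, V (Complex.I • x) = -(Complex.I • V x) := by
    intro x hx
    refine closure_minimal (s := (P.range : Set H))
      (t := {x | V (Complex.I • x) = -(Complex.I • V x)}) ?_
      (isClosed_eq (by fun_prop) (by fun_prop)) hx
    rintro _ ⟨y, rfl⟩
    change V (Complex.I • P y) = -(Complex.I • V (P y))
    rw [← map_smul, hVP, hVP, hA]
  -- `W` is `J` extended by zero to `M`.
  let W : H →L[ℝ] H := (Mᗮ.subtypeL.restrictScalars ℝ).comp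
    (J.comp (Mᗮ.orthogonalProjectionOnto.restrictScalars ℝ))
  have hW0 : ∀ x ∈ M, W x = 0 := by
    intro x hx
    change ((J (Mᗮ.orthogonalProjectionOnto x) : Mᗮ) : H) = 0
    rw [Submodule.orthogonalProjectionOnto_apply_of_mem_orthogonal
      (M.le_orthogonal_orthogonal hx), map_zero, Submodule.coe_zero]
  have hWJ : ∀ x : Mᗮ, W x = J x := by
    intro x
    change ((J (Mᗮ.orthogonalProjectionOnto x) : Mᗮ) : H) = _
    rw [Submodule.orthogonalProjectionOnto_mem_subspace_eq_self]
  have hWM : ∀ x, W x ∈ Mᗮ := fun x => (J (Mᗮ.orthogonalProjectionOnto x)).2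
  have hτ : ∀ m ∈ M, ∀ n : Mᗮ, (V + W) (m + n) = V m + J n := by
    intro m hm n
    rw [map_add, add_apply, add_apply, hW0 m hm, hV0 n n.2, hWJ, add_zero, zero_add]
  refine ⟨V + W, ⟨fun x => ?_, fun x => ?_, fun x => ?_⟩, ?_, ?_⟩
  · obtain ⟨m, hm, n, hn, rfl⟩ := hdecomp x
    lift n to Mᗮ using hn
    rw [hτ m hm, smul_add, ← Submodule.coe_smul, hτ _ (M.smul_mem _ hm), hVI m hm,
      hJ.antilinear, Submodule.coe_neg, Submodule.coe_smul, smul_add, neg_add]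
  · obtain ⟨m, hm, n, hn, rfl⟩ := hdecomp x
    lift n to Mᗮ using hn
    rw [hτ m hm, hτ _ (hVM m hm), hVV m hm, hJ.involutive]
  · obtain ⟨m, hm, n, hn, rfl⟩ := hdecomp x
    lift n to Mᗮ using hn
    rw [hτ m hm, ← sq_eq_sq₀ (norm_nonneg _) (norm_nonneg _), sq, sq,
      norm_add_sq_eq_norm_sq_add_norm_sq_of_inner_eq_zero (𝕜 := ℂ) _ _
        ((Submodule.mem_orthogonal M _).1 (J n).2 _ (hVM m hm)),
      norm_add_sq_eq_norm_sq_add_norm_sq_of_inner_eq_zero (𝕜 := ℂ) _ _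
        ((Submodule.mem_orthogonal M _).1 n.2 _ hm), hVnorm m hm, ← Submodule.coe_norm,
      hJ.isometric, Submodule.coe_norm]
  · ext x
    change A x = P (V x + W x)
    rw [map_add, hP0 _ (hWM x), add_zero, hPV, hVP]
  · ext x
    change A x = V (P x) + W (P x)
    rw [hW0 _ (hPM x), add_zero, hVP]

end Modulus

/-! ### The spectrum of the modulus. -/

section AntilinearSpectrum

variable {H : Type*} [NormedAddCommGroup H] [InnerProductSpace ℂ H] [CompleteSpace H]

/-- Invertibility as a real linear and as a complex linear operator are equivalent. -/
theorem isUnit_restrictScalars_iff (T : H →L[ℂ] H) :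
    IsUnit (T.restrictScalars ℝ) ↔ IsUnit T := by
  rw [ContinuousLinearMap.isUnit_iff_bijective, ContinuousLinearMap.isUnit_iff_bijective]
  rfl

/-- Conjugation with multiplication by `i` maps `A - r` to `-(A + r)`. -/
theorem IsAntilinear.isUnit_add_of_isUnit_sub {A : H →L[ℝ] H} (hA : IsAntilinear A) {r : ℝ}
    (h : IsUnit (A - r • (1 : H →L[ℝ] H))) : IsUnit (A + r • (1 : H →L[ℝ] H)) := by
  rw [ContinuousLinearMap.isUnit_iff_bijective] at h ⊢
  have hI : ∀ x, (A + r • (1 : H →L[ℝ] H)) x =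
      Complex.I • (A - r • (1 : H →L[ℝ] H)) (Complex.I • x) := by
    intro x
    change A x + r • x = Complex.I • (A (Complex.I • x) - r • (Complex.I • x))
    rw [hA, smul_sub, smul_neg, smul_smul, smul_comm r Complex.I x, smul_smul, Complex.I_mul_I]
    simp
  have hb : Function.Bijective fun x : H => Complex.I • x :=
    MulAction.bijective₀ Complex.I_ne_zero
  have : ⇑(A + r • (1 : H →L[ℝ] H)) = (fun x : H => Complex.I • x) ∘
      ⇑(A - r • (1 : H →L[ℝ] H)) ∘ fun x : H => Complex.I • x := funext hI
  rw [this]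
  exact hb.comp (h.comp hb)

/-- For commuting factors, a product is invertible exactly when both factors are. Invertibility of
`A - r` implies that of `A + r` by antilinearity, and `|A| + r` is invertible for `r > 0` by
positivity, so for `r ≥ 0` each product is governed by its factor with `-r`. -/
theorem IsAntilinear.spectrum_modulus {A : H →L[ℝ] H} (hA : IsAntilinear A)
    (h : IsRealSelfAdjoint A) :
    spectrum ℝ hA.modulus = {r : ℝ | 0 ≤ r ∧ (r : ℂ) ∈ realLinearSpectrum A} := by
  set P : H →L[ℝ] H := hA.modulus.restrictScalars ℝ with hP
  have hPP : P * P = A * A := by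
    ext x
    exact hA.modulus_modulus_of_selfAdjoint h x
  have hmem : ∀ r : ℝ, r ∈ spectrum ℝ hA.modulus ↔ ¬ IsUnit (P - r • (1 : H →L[ℝ] H)) := by
    intro r
    rw [spectrum.mem_iff, ← neg_sub, IsUnit.neg_iff, Algebra.algebraMap_eq_smul_one,
      ← isUnit_restrictScalars_iff]
    rfl
  have hiff : ∀ r : ℝ, IsUnit (A - r • (1 : H →L[ℝ] H)) ∧ IsUnit (A + r • (1 : H →L[ℝ] H)) ↔
      IsUnit (P - r • (1 : H →L[ℝ] H)) ∧ IsUnit (P + r • (1 : H →L[ℝ] H)) := by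
    intro r
    rw [← (commute_sub_add A r).isUnit_mul_iff, ← (commute_sub_add P r).isUnit_mul_iff,
      (sub_smul_one_mul_add_smul_one A r).1, (sub_smul_one_mul_add_smul_one P r).1, hPP]
  have hadd : ∀ r : ℝ, 0 ≤ r → IsUnit (P - r • (1 : H →L[ℝ] H)) →
      IsUnit (P + r • (1 : H →L[ℝ] H)) := by
    intro r hr hu
    rcases hr.eq_or_lt with rfl | hr
    · simpa using hu
    · by_contra hn
      have hmem' : -r ∈ spectrum ℝ hA.modulus := by
        rw [hmem]
        simpa using hn
      have := spectrum_nonneg_of_nonneg hA.modulus_nonneg hmem'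
      linarith
  ext r
  rw [Set.mem_ofPred_eq, mem_realLinearSpectrum_ofReal]
  constructor
  · intro hr
    have hr0 : 0 ≤ r := spectrum_nonneg_of_nonneg hA.modulus_nonneg hr
    exact ⟨hr0, fun hu => (hmem r).1 hr ((hiff r).1 ⟨hu, hA.isUnit_add_of_isUnit_sub hu⟩).1⟩
  · rintro ⟨hr0, hu⟩
    rw [hmem]
    exact fun hn => hu ((hiff r).2 ⟨hn, hadd r hr0 hn⟩).1

end AntilinearSpectrum

/-! ### The antilinear measure `F(M) = E(M) τ`. -/

section AntilinearMeasure

variable {H : Type*} [NormedAddCommGroup H] [InnerProductSpace ℂ H] [CompleteSpace H]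
variable {A : H →L[ℝ] H} {hA : IsAntilinear A} {τ : H →L[ℝ] H}

theorem IsPolarConjugation.apply_modulus_comm (hτ : IsPolarConjugation hA τ) (x : H) :
    τ (hA.modulus x) = hA.modulus (τ x) :=
  (congrArg (fun T : H →L[ℝ] H => T x) hτ.eq_mul_modulus).symm.trans
    (congrArg (fun T : H →L[ℝ] H => T x) hτ.eq_modulus_mul)

variable {Ω : Type*} [MeasurableSpace Ω] {E : SpectralMeasure Ω H}

theorem antilinearSpectralMeasure_apply (M : Set Ω) (x : H) :
    antilinearSpectralMeasure E τ M x = E.toFun M (τ x) := rfl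

/-- Right multiplication by `τ` is norm continuous and carries integrals of simple functions against
`E` to those against `F`. -/
theorem hasSpectralIntegral_antilinearSpectralMeasure {f : Ω → ℝ} {T : H →L[ℂ] H}
    (h : HasSpectralIntegral E.toFun f T) :
    HasSpectralIntegral (antilinearSpectralMeasure E τ) f (T.restrictScalars ℝ * τ) := by
  refine ⟨h.1, fun s hs => ?_⟩
  have hsum : ∀ n, simpleSpectralIntegral (antilinearSpectralMeasure E τ) (s n) =
      (simpleSpectralIntegral E.toFun (s n)).restrictScalars ℝ * τ := by
    intro n
    ext x
    simp [simpleSpectralIntegral, antilinearSpectralMeasure]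
  simp only [hsum]
  have hc : Continuous fun S : H →L[ℂ] H => S.restrictScalars ℝ * τ :=
    (ContinuousLinearMap.continuous_restrictScalars ℝ).mul continuous_const
  exact (hc.tendsto T).comp (h.2 s hs)

theorem isAntilinear_antilinearSpectralMeasure (hτ : IsAntilinear τ) (M : Set Ω) :
    IsAntilinear (antilinearSpectralMeasure E τ M) := by
  intro x
  rw [antilinearSpectralMeasure_apply, antilinearSpectralMeasure_apply, hτ, map_neg, map_smul]

variable {M : Set Ω}

theorem SpectralMeasure.apply_apply (E : SpectralMeasure Ω H) (hM : MeasurableSet M) (x : H) :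
    E.toFun M (E.toFun M x) = E.toFun M x :=
  congrArg (fun T : H →L[ℂ] H => T x) (E.isStarProjection M hM).isIdempotentElem.eq

theorem SpectralMeasure.inner_left (E : SpectralMeasure Ω H) (hM : MeasurableSet M) (x y : H) :
    inner ℂ (E.toFun M x) y = inner ℂ x (E.toFun M y) :=
  (E.isStarProjection M hM).isSelfAdjoint.isSymmetric x y

theorem antilinearSpectralMeasure_mul_self (hτ : IsUnitaryConjugation τ) (hM : MeasurableSet M)
    (hcomm : ∀ x, τ (E.toFun M x) = E.toFun M (τ x)) :
    antilinearSpectralMeasure E τ M * antilinearSpectralMeasure E τ M =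
      (E.toFun M).restrictScalars ℝ := by
  ext x
  change E.toFun M (τ (E.toFun M (τ x))) = E.toFun M x
  rw [hcomm, hτ.involutive, E.apply_apply hM]

theorem isRealSelfAdjoint_antilinearSpectralMeasure (hτ : IsUnitaryConjugation τ)
    (hM : MeasurableSet M) (hcomm : ∀ x, τ (E.toFun M x) = E.toFun M (τ x)) :
    IsRealSelfAdjoint (antilinearSpectralMeasure E τ M) := by
  refine isRealSelfAdjoint_of_re_inner_eq fun x y => ?_
  rw [antilinearSpectralMeasure_apply, antilinearSpectralMeasure_apply, E.inner_left hM,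
    hτ.re_inner_left, hcomm]

theorem isAntilinearProjectionOnto_antilinearSpectralMeasure (hτ : IsUnitaryConjugation τ)
    (hM : MeasurableSet M) (hcomm : ∀ x, τ (E.toFun M x) = E.toFun M (τ x)) :
    IsAntilinearProjectionOnto (antilinearSpectralMeasure E τ M) (E.toFun M).range := by
  have hfix : ∀ x ∈ (E.toFun M).range, E.toFun M x = x := by
    rintro _ ⟨y, rfl⟩
    exact E.apply_apply hM y
  -- On the range of `E(M)`, commutation makes `F(M)` coincide with `τ`, which supplies the
  -- involution and the isometry.
  have hval : ∀ x ∈ (E.toFun M).range, antilinearSpectralMeasure E τ M x = τ x := by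
    intro x hx
    rw [antilinearSpectralMeasure_apply, ← hcomm, hfix x hx]
  have hmaps : ∀ x ∈ (E.toFun M).range,
      antilinearSpectralMeasure E τ M x ∈ (E.toFun M).range := fun x _ => ⟨τ x, rfl⟩
  refine ⟨?_, hmaps, fun x _ => isAntilinear_antilinearSpectralMeasure hτ.antilinear M x,
    fun x hx => ?_, fun x hx => ?_, fun x hx => ?_⟩
  · have : ((E.toFun M).range : Set H) = {x | E.toFun M x = x} :=
      Set.Subset.antisymm hfix fun x hx => ⟨x, hx⟩
    rw [this]
    exact isClosed_eq (E.toFun M).continuous continuous_id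
  · rw [hval _ (hmaps x hx), hval x hx, hτ.involutive]
  · rw [hval x hx, hτ.isometric]
  · have h0 : E.toFun M x = 0 := by
      refine (inner_self_eq_zero (𝕜 := ℂ)).1 ?_
      rw [E.inner_left hM, E.apply_apply hM, ← E.inner_left hM]
      exact (Submodule.mem_orthogonal _ x).1 hx _ ⟨x, rfl⟩
    rw [antilinearSpectralMeasure_apply, ← hcomm, h0, map_zero]

theorem antilinearSpectralMeasure_univ : antilinearSpectralMeasure E τ Set.univ = τ := by
  ext x
  rw [antilinearSpectralMeasure_apply, E.map_univ]
  rfl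

end AntilinearMeasure

/-! ### The theorem, assembled from both halves. -/

theorem theorem4p2 {H : Type*} [NormedAddCommGroup H] [InnerProductSpace ℂ H] [CompleteSpace H] :
    -- spectral measures of complex linear self-adjoint operators, and commutation with them
    (∀ T : H →L[ℂ] H, IsSelfAdjoint T →
      (∃! E : SpectralMeasure (spectrum ℝ T) H, IsSpectralMeasureOf T E) ∧
      ∀ E : SpectralMeasure (spectrum ℝ T) H, IsSpectralMeasureOf T E →
        ∀ τ : H →L[ℝ] H, IsAntilinear τ →
          τ * T.restrictScalars ℝ = T.restrictScalars ℝ * τ →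
          ∀ M : Set (spectrum ℝ T), MeasurableSet M →
            (E.toFun M).restrictScalars ℝ * τ = τ * (E.toFun M).restrictScalars ℝ) ∧
    -- the spectral integral of an antilinear self-adjoint operator
    (∀ (A : H →L[ℝ] H) (hA : IsAntilinear A), IsRealSelfAdjoint A →
      hA.modulus.IsPositive ∧
      hA.modulus.restrictScalars ℝ * hA.modulus.restrictScalars ℝ = realAdjoint A * A ∧
      spectrum ℝ hA.modulus = {r : ℝ | 0 ≤ r ∧ (r : ℂ) ∈ realLinearSpectrum A} ∧
      (∃ τ : H →L[ℝ] H, IsPolarConjugation hA τ) ∧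
      ∀ τ : H →L[ℝ] H, IsPolarConjugation hA τ →
        ∀ E : SpectralMeasure (spectrum ℝ hA.modulus) H, IsSpectralMeasureOf hA.modulus E →
          HasSpectralIntegral (antilinearSpectralMeasure E τ) (fun t => (t : ℝ)) A ∧
          (∀ M : Set (spectrum ℝ hA.modulus), MeasurableSet M →
            IsAntilinear (antilinearSpectralMeasure E τ M) ∧
            IsAntilinearProjectionOnto (antilinearSpectralMeasure E τ M) (E.toFun M).range ∧
            antilinearSpectralMeasure E τ M * antilinearSpectralMeasure E τ M =
              (E.toFun M).restrictScalars ℝ ∧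
            IsRealSelfAdjoint (antilinearSpectralMeasure E τ M)) ∧
          antilinearSpectralMeasure E τ Set.univ = τ ∧
          ∀ M : ℕ → Set (spectrum ℝ hA.modulus), (∀ n, MeasurableSet (M n)) →
            Pairwise (fun m n => Disjoint (M m) (M n)) →
            ∀ x, HasSum (fun n => antilinearSpectralMeasure E τ (M n) x)
              (antilinearSpectralMeasure E τ (⋃ n, M n) x)) := by
  refine ⟨fun T hT => ⟨?_, fun E hE τ _ hτ M hM => ?_⟩, fun A hA h => ⟨?_, ?_,
    hA.spectrum_modulus h, hA.exists_isPolarConjugation h, fun τ hτ E hE => ?_⟩⟩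
  · obtain ⟨E, hE, -⟩ := exists_isSpectralMeasureOf hT
    exact ⟨E, hE, fun F hF => isSpectralMeasureOf_unique hF hE⟩
  · ext x
    exact (hE.apply_comm_of_real hT
      (fun y => congrArg (fun S : H →L[ℝ] H => S y) hτ) hM x).symm
  · exact (ContinuousLinearMap.nonneg_iff_isPositive _).1 hA.modulus_nonneg
  · ext x
    exact hA.modulus_modulus x
  · have hc := hτ.isUnitaryConjugation
    have hcomm : ∀ M, MeasurableSet M → ∀ x, τ (E.toFun M x) = E.toFun M (τ x) :=
      fun M hM => hE.apply_comm_of_real hA.modulus_isSelfAdjoint hτ.apply_modulus_comm hM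
    refine ⟨?_, fun M hM => ⟨isAntilinear_antilinearSpectralMeasure hc.antilinear M,
      isAntilinearProjectionOnto_antilinearSpectralMeasure hc hM (hcomm M hM),
      antilinearSpectralMeasure_mul_self hc hM (hcomm M hM),
      isRealSelfAdjoint_antilinearSpectralMeasure hc hM (hcomm M hM)⟩,
      antilinearSpectralMeasure_univ, fun M hM hd x => E.hasSum_iUnion M hM hd (τ x)⟩
    have hi := hasSpectralIntegral_antilinearSpectralMeasure (τ := τ) hE
    rwa [← hτ.eq_modulus_mul] at hi
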